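/- Let $1\le k\le n$ and let $\Lambda=\mathbb{Z}[t_1,\dots,t_n]$, where the index of a weight is always read modulo $n$, i.e. $t_{i+n}=t_i$. For a partition $\lambda$ (drawn in the English convention) put $$s_\lambda(x|t)=\sum_T\prod_{\alpha\in\lambda}\bigl(x_{T(\alpha)}-t_{T(\alpha)+c(\alpha)}\bigr)\in\Lambda[x_1,\dots,x_k],$$ where $T$ runs over the semistandard tableaux of shape $\lambda$ with entries in $\{1,\dots,k\}$ and $c(\alpha)=j-i$ for the box $\alpha$ in row $i$ and column $j$. Let $e_i(x|t)=s_{(1)^i}(x|t)$, $h_i(x|t)=s_{(i)}(x|t)$, and $$R=\Lambda[q,e_1(x|t),\dots,e_k(x|t)]/J,\qquad J=\langle h_{n-k+1}(x|t),\dots,h_{n-1}(x|t),\,h_n(x|t)+(-1)^kq\rangle .$$ The rim of $\lambda$ is the set of boxes $(i,j)\in\lambda$ with $(i+1,j+1)\notin\lambda$. An $n$-rim hook of $\lambda$ is an edge-connected set of $n$ boxes of the rim whose removal leaves the diagram of a partition; its height $h$ is the number of rows that it meets. An illegal $n$-rim hook of $\lambda$ is an edge-connected set of $n$ boxes of the rim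 which starts at the last box of a row, moves down and to the left, and ends at a box that has a box of $\lambda$ directly below it (so that removing it does not leave a partition). Then every $s_\lambda(x|t)$ lies in $\Lambda[q,e_1(x|t),\dots,e_k(x|t)]$, and for every partition $\lambda$: (a) if $\lambda_1>n-k$ and $\lambda$ has no $n$-rim hook, then $s_\lambda(x|t)\equiv 0 \bmod J$; (b) if $\lambda_{k+1}>0$, then $s_\lambda(x|t)\equiv 0\bmod J$; (c) if $\lambda$ contains an illegal $n$-rim hook, then $s_\lambda(x|t)\equiv 0\bmod J$; (d) if $\lambda$ has at most $k$ rows and $\nu$ is obtained from $\lambda$ by removing an $n$-rim hook of height $h$, then $s_\lambda(x|t)\equiv(-1)^{k-h}\,q\,s_\nu(x|t)\bmod J$. -/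

import Mathlib

namespace EquivRimHook

noncomputable section

/-! ### Polynomial rings -/

/-- `Λ = ℤ[t₁, …, tₙ]`. The torus weights are indexed by residues modulo `n`, so that `t_i` makes
sense for every integer index `i` and `t_{i+n} = t_i`. Only used for `n ≥ 1`. -/
abbrev Weights (n : ℕ) : Type := MvPolynomial (ZMod n) ℤ

/-- `Λ[q]`. -/
def QWeights (n : ℕ) : Type := Polynomial (Weights n)

instance (n : ℕ) : CommRing (QWeights n) := inferInstanceAs (CommRing (Polynomial (Weights n)))

/-- The torus weight `t_i`, with its index read modulo `n`, in `Λ[q]`. -/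
def tWeight (n : ℕ) (i : ℤ) : QWeights n :=
  (Polynomial.C (MvPolynomial.X (i : ZMod n)) : Polynomial (Weights n))

/-- The quantum parameter `q` in `Λ[q]`. -/
def qParam (n : ℕ) : QWeights n := (Polynomial.X : Polynomial (Weights n))

/-- `Λ[q][x₁, …, x_k]`; the variable `x_a` (`1 ≤ a ≤ k`) is `X (a - 1)`. -/
abbrev XPoly (k n : ℕ) : Type := MvPolynomial (Fin k) (QWeights n)

/-! ### Factorial Schur polynomials

A partition is a `YoungDiagram`: its boxes are pairs `(i, j)` (row, column), counted from `0`,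
in the English convention, so `λ_{i+1} = μ.rowLen i`. -/

/-- Semistandard fillings of `μ` by the `k` letters `1, …, k` (stored as `Fin k`, that is, shifted
by one): weakly increasing along rows, strictly increasing down columns. -/
def IsSemistandard {k : ℕ} {μ : YoungDiagram} (T : μ.cells → Fin k) : Prop :=
  (∀ a b : μ.cells, a.1.1 = b.1.1 → a.1.2 ≤ b.1.2 → T a ≤ T b) ∧
  (∀ a b : μ.cells, a.1.2 = b.1.2 → a.1.1 < b.1.1 → T a < T b)

open Classical in
/-- The (cyclic) factorial Schur polynomial
`s_μ(x|t) = ∑_T ∏_α (x_{T(α)} - t_{T(α) + c(α)})`, where `c(α)` is column minus row. The letter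
in box `α` is `T α + 1`, since `Fin k` counts from `0`. -/
def factorialSchur (k n : ℕ) (μ : YoungDiagram) : XPoly k n :=
  ∑ T ∈ (Finset.univ : Finset (μ.cells → Fin k)).filter IsSemistandard,
    ∏ a : μ.cells,
      (MvPolynomial.X (T a) -
        MvPolynomial.C (tWeight n ((((T a : ℕ) : ℤ) + 1) + ((a.1.2 : ℤ) - (a.1.1 : ℤ)))))

/-- The one-row partition `(m)`. -/
def rowShape (m : ℕ) : YoungDiagram := YoungDiagram.ofRowLens [m]
  (List.pairwise_singleton _ m).sortedGE

/-- The one-column partition `(1)^m`. -/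
def colShape (m : ℕ) : YoungDiagram :=
  YoungDiagram.ofRowLens (List.replicate m 1)
    (List.Pairwise.sortedGE (List.pairwise_replicate.2 (Or.inr le_rfl)))

/-- `h_m(x|t) = s_{(m)}(x|t)`. -/
def factorialH (k n m : ℕ) : XPoly k n := factorialSchur k n (rowShape m)

/-- `e_m(x|t) = s_{(1)^m}(x|t)`. -/
def factorialE (k n m : ℕ) : XPoly k n := factorialSchur k n (colShape m)

/-! ### The ring `R` -/

/-- `Λ[q, e₁(x|t), …, e_k(x|t)]`, as a subalgebra of `Λ[q][x₁, …, x_k]`. -/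
abbrev SymRing (k n : ℕ) : Subalgebra (QWeights n) (XPoly k n) :=
  Algebra.adjoin (QWeights n) {f | ∃ i : ℕ, 1 ≤ i ∧ i ≤ k ∧ f = factorialE k n i}

/-- The ideal `J = ⟨h_{n-k+1}(x|t), …, h_{n-1}(x|t), h_n(x|t) + (-1)^k q⟩` of
`Λ[q, e₁(x|t), …, e_k(x|t)]`. -/
def J (k n : ℕ) : Ideal (SymRing k n) :=
  Ideal.span
    ({f | ∃ m : ℕ, n - k + 1 ≤ m ∧ m ≤ n - 1 ∧ (f : XPoly k n) = factorialH k n m} ∪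
     {f | (f : XPoly k n) = factorialH k n n + (-1) ^ k * MvPolynomial.C (qParam n)})

/-- `R = Λ[q, e₁(x|t), …, e_k(x|t)] / J`. -/
abbrev R (k n : ℕ) : Type := SymRing k n ⧸ J k n

/-- The class of `q` in `R`. -/
def qR (k n : ℕ) : R k n :=
  Ideal.Quotient.mk (J k n) (algebraMap (QWeights n) (SymRing k n) (qParam n))

/-! ### Rim hooks -/

/-- The rim of `μ`: the boxes of `μ` with no box of `μ` diagonally south-east of them. -/
def rim (μ : YoungDiagram) : Finset (ℕ × ℕ) :=
  μ.cells.filter fun c => (c.1 + 1, c.2 + 1) ∉ μ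

/-- Two boxes share an edge. -/
def BoxAdj (a b : ℕ × ℕ) : Prop :=
  (a.1 = b.1 ∧ (a.2 + 1 = b.2 ∨ b.2 + 1 = a.2)) ∨
  (a.2 = b.2 ∧ (a.1 + 1 = b.1 ∨ b.1 + 1 = a.1))

/-- `B` is a connected strip of `n` boxes along the rim of `μ`. -/
def IsRimStrip (μ : YoungDiagram) (n : ℕ) (B : Finset (ℕ × ℕ)) : Prop :=
  B ⊆ rim μ ∧ B.card = n ∧
  ∀ a ∈ B, ∀ b ∈ B, Relation.ReflTransGen (fun c d => c ∈ B ∧ d ∈ B ∧ BoxAdj c d) a b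

/-- `B` is an `n`-rim hook of `μ` and removing it leaves the partition `ν`. -/
def RemovesRimHook (μ : YoungDiagram) (n : ℕ) (B : Finset (ℕ × ℕ)) (ν : YoungDiagram) : Prop :=
  IsRimStrip μ n B ∧ ν.cells = μ.cells \ B

/-- `μ` contains a (legal) `n`-rim hook. -/
def HasRimHook (μ : YoungDiagram) (n : ℕ) : Prop := ∃ B ν, RemovesRimHook μ n B ν

/-- `B` is an illegal `n`-rim hook of `μ`: a strip of `n` boxes of the rim which starts at the last
box of row `r`, moves down and to the left, and ends at a box `(s, c)` that still has a box of `μ`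
below it. -/
def IsIllegalRimHook (μ : YoungDiagram) (n : ℕ) (B : Finset (ℕ × ℕ)) : Prop :=
  IsRimStrip μ n B ∧
  (∃ r j, (r, j) ∈ B ∧ (r, j + 1) ∉ μ ∧ ∀ b ∈ B, r ≤ b.1) ∧
  (∃ s c, (s, c) ∈ B ∧ (s + 1, c) ∈ μ ∧ ∀ b ∈ B, b.1 ≤ s ∧ c ≤ b.2)

/-- The height of a rim hook: the number of rows it meets. -/
def height (B : Finset (ℕ × ℕ)) : ℕ := (B.image Prod.fst).card

end

end EquivRimHook

/-!
Write `(y|t)^r = (y - t₁) ⋯ (y - t_r)`. The tableau sum satisfies the bialternant formula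
`s_λ(x|t) · det[(x_i|t)^(k-j)] = det[(x_i|t)^(λ_j + k - j)]` for `λ` with at most `k` rows
(`tableauSum_mul_facVandermonde`). It is proved by induction on `k`: the boxes that carry the
largest letter form a horizontal strip, and column operations that clear the row of `x_k` from the
determinant produce the same sum over strips, by telescoping.

Let `S = Λ[q, e₁(x|t), …, e_k(x|t)]`. Expanding the Vandermonde determinant in `x₁, …, x_k, y` along
the row of `y` shows that `G(y) = ∏ (y - x_i)` has coefficients in `S` (`exists_map_eq_prod`).
Dividing by `G` in `S[y]` turns the ratio of determinants into the determinant of the coordinates of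
the residues of `(y|t)^(λ_j + k - j)` in the basis `y^(k-1), …, 1` of `S[y] / G`. Hence `s_λ` lies in
`S`, and its image in a quotient of `S` is computed by the same determinant there
(`coe_schurSym`, `map_schurSym`).

In particular `h_m(x|t)` is the top coordinate of `(y|t)^(m+k-1)`. As the weights have period `n`,
`(y|t)^(n+i) = (y|t)^n (y|t)^i`, so modulo `J` the polynomials `(y|t)^n` and `(-1)^(k-1) q` have the
same products with `(y|t)^0, …, (y|t)^(k-1)` in the top coordinate. This pairing is nondegenerate,
so `(y|t)^n = (-1)^(k-1) q` modulo `G` (`SatisfiesRelations.facPoly_period`). Lowering one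
exponent by `n` therefore multiplies the determinant by `(-1)^(k-1) q`.

The rest is the combinatorics of the exponents `λ_j + k - j`. Removing an `n`-rim hook of height `h`
lowers one exponent by `n` and moves it past `h - 1` others (`RemovesRimHook.exists_rows`), whence
the sign `(-1)^(k-h)`. An illegal rim hook, or a first row longer than `n - k` without a rim hook,
makes two exponents differ by `n`, and then two columns become proportional
(`IsIllegalRimHook.exists_betaNumber`, `exists_betaNumber_of_not_hasRimHook`).
-/

namespace EquivRimHook

noncomputable section

/-! ### Tableaux and the branching rule -/

section

variable {B : Type*} [CommRing B]

/-- The boxes of the diagram with `k` rows of lengths `l 0, …, l (k - 1)`. -/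
def cellsOf {k : ℕ} (l : Fin k → ℕ) : Finset (ℕ × ℕ) :=
  Finset.univ.biUnion fun i => (Finset.range (l i)).image fun j => ((i : ℕ), j)

theorem mem_cellsOf {k : ℕ} {l : Fin k → ℕ} {a : ℕ × ℕ} :
    a ∈ cellsOf l ↔ ∃ i : Fin k, a.1 = i ∧ a.2 < l i := by
  rcases a with ⟨a, b⟩
  simp only [cellsOf, Finset.mem_biUnion, Finset.mem_univ, true_and, Finset.mem_image,
    Finset.mem_range, Prod.mk.injEq]
  constructor
  · rintro ⟨i, j, hj, rfl, rfl⟩; exact ⟨i, rfl, hj⟩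
  · rintro ⟨i, rfl, hj⟩; exact ⟨i, b, hj, rfl, rfl⟩

theorem mk_mem_cellsOf {k : ℕ} {l : Fin k → ℕ} {i : Fin k} {j : ℕ} :
    ((i : ℕ), j) ∈ cellsOf l ↔ j < l i := by
  rw [mem_cellsOf]
  constructor
  · rintro ⟨i', h, h'⟩
    rwa [Fin.ext h]
  · exact fun h => ⟨i, rfl, h⟩

theorem cellsOf_injective {k : ℕ} : Function.Injective (cellsOf (k := k)) := by
  intro l l' h
  funext i
  refine le_antisymm (le_of_not_gt fun hi => ?_) (le_of_not_gt fun hi => ?_)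
  · exact lt_irrefl _ (mk_mem_cellsOf.1 (h ▸ mk_mem_cellsOf.2 hi))
  · exact lt_irrefl _ (mk_mem_cellsOf.1 (h.symm ▸ mk_mem_cellsOf.2 hi))

/-- Semistandard fillings of an arbitrary finite set of boxes by the letters of `Fin k`. -/
def IsSemistandardOn {k : ℕ} {C : Finset (ℕ × ℕ)} (T : C → Fin k) : Prop :=
  (∀ a b : C, a.1.1 = b.1.1 → a.1.2 ≤ b.1.2 → T a ≤ T b) ∧
  (∀ a b : C, a.1.2 = b.1.2 → a.1.1 < b.1.1 → T a < T b)

open Classical in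
/-- The factorial Schur sum over the semistandard fillings of a finite set of boxes, evaluated at
`k` elements `x 0, …, x (k - 1)` of a commutative ring, with an arbitrary sequence of weights. -/
def tableauSum (x : ℕ → B) (t : ℤ → B) (k : ℕ) (C : Finset (ℕ × ℕ)) : B :=
  ∑ T ∈ (Finset.univ : Finset (C → Fin k)).filter IsSemistandardOn,
    ∏ a : C, (x (T a) - t ((((T a : ℕ) : ℤ) + 1) + ((a.1.2 : ℤ) - (a.1.1 : ℤ))))

/-- In a semistandard filling of a left-justified diagram, the letters of row `i` are at
least `i`. -/
theorem IsSemistandardOn.row_le {k m : ℕ} {l : Fin m → ℕ} (hl : Antitone l)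
    {T : cellsOf l → Fin k} (hT : IsSemistandardOn T) :
    ∀ (i : Fin m) (j : ℕ) (h : ((i : ℕ), j) ∈ cellsOf l), (i : ℕ) ≤ T ⟨_, h⟩ := by
  rintro ⟨i, hi⟩
  induction i with
  | zero => intro j h; exact Nat.zero_le _
  | succ i ih =>
    intro j h
    have hi' : i < m := by omega
    have h' : (((⟨i, hi'⟩ : Fin m) : ℕ), j) ∈ cellsOf l := by
      rw [mk_mem_cellsOf] at h ⊢
      exact h.trans_le (hl (Fin.mk_le_mk.2 (Nat.le_succ i)))
    have h1 := ih hi' j h'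
    have h2 := hT.2 ⟨_, h'⟩ ⟨_, h⟩ rfl (Nat.lt_succ_self i)
    have h3 : (T ⟨_, h'⟩ : ℕ) < T ⟨_, h⟩ := h2
    simp only at h1 h3 ⊢
    omega

/-- The boxes of `l` whose letter is not the largest one are those of `ν`. -/
def Compatible {k : ℕ} {l : Fin (k + 1) → ℕ} (T : cellsOf l → Fin (k + 1)) (ν : Fin k → ℕ) :
    Prop :=
  ∀ a : cellsOf l, T a ≠ Fin.last k ↔ a.1 ∈ cellsOf ν

/-- The row lengths that interlace those of `l`. -/
def interlacing {k : ℕ} (l : Fin (k + 1) → ℕ) : Finset (Fin k → ℕ) :=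
  Fintype.piFinset fun i => Finset.Icc (l i.succ) (l i.castSucc)

theorem mem_interlacing {k : ℕ} {l : Fin (k + 1) → ℕ} {ν : Fin k → ℕ} :
    ν ∈ interlacing l ↔ ∀ i, l i.succ ≤ ν i ∧ ν i ≤ l i.castSucc := by
  simp [interlacing, Fintype.mem_piFinset]

theorem antitone_of_mem_interlacing {k : ℕ} {l : Fin (k + 1) → ℕ} (hl : Antitone l)
    {ν : Fin k → ℕ} (hν : ν ∈ interlacing l) : Antitone ν := by
  rw [mem_interlacing] at hν
  intro i j hij
  rcases hij.eq_or_lt with rfl | hij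
  · exact le_rfl
  · exact (hν j).2.trans ((hl (show i.succ ≤ j.castSucc from hij)).trans (hν i).1)

theorem cellsOf_subset_of_mem_interlacing {k : ℕ} {l : Fin (k + 1) → ℕ}
    {ν : Fin k → ℕ} (hν : ν ∈ interlacing l) : cellsOf ν ⊆ cellsOf l := by
  rw [mem_interlacing] at hν
  intro a ha
  obtain ⟨i, hi, hj⟩ := mem_cellsOf.1 ha
  exact mem_cellsOf.2 ⟨i.castSucc, hi, hj.trans_le (hν i).2⟩

theorem exists_compatible {k : ℕ} {l : Fin (k + 1) → ℕ} (hl : Antitone l)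
    {T : cellsOf l → Fin (k + 1)} (hT : IsSemistandardOn T) :
    ∃ ν ∈ interlacing l, Compatible T ν := by
  classical
  have hex : ∀ i : Fin k, ∃ j : ℕ, l i.castSucc ≤ j ∨
      ∃ h : (((i.castSucc : Fin (k + 1)) : ℕ), j) ∈ cellsOf l, T ⟨_, h⟩ = Fin.last k :=
    fun i => ⟨_, Or.inl le_rfl⟩
  refine ⟨fun i => Nat.find (hex i), mem_interlacing.2 fun i => ⟨?_, ?_⟩, ?_⟩
  · by_contra! hlt
    rcases Nat.find_spec (hex i) with h | ⟨h, hT'⟩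
    · have := hl (show i.castSucc ≤ i.succ from (Fin.castSucc_lt_succ (i := i)).le)
      omega
    · have := hT.2 ⟨_, h⟩ ⟨_, mk_mem_cellsOf.2 hlt⟩ rfl (by simp)
      rw [hT'] at this
      exact absurd this (not_lt.2 (Fin.le_last _))
  · exact Nat.find_min' _ (Or.inl le_rfl)
  · rintro ⟨⟨i, j⟩, h⟩
    obtain ⟨i', hi, hj⟩ := mem_cellsOf.1 h
    simp only at hi hj
    subst hi
    rcases Fin.eq_castSucc_or_eq_last i' with ⟨i, rfl⟩ | rfl
    · have e : ((i.castSucc : Fin (k + 1)) : ℕ) = (i : ℕ) := rfl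
      have e2 : ((((i.castSucc : Fin (k + 1)) : ℕ), j) ∈ cellsOf fun i => Nat.find (hex i)) ↔
          j < Nat.find (hex i) := mk_mem_cellsOf (i := i)
      rw [e2]
      constructor
      · intro hne
        by_contra! hle
        rcases Nat.find_spec (hex i) with h' | ⟨h', hT'⟩
        · omega
        · have := hT.1 ⟨_, h'⟩ ⟨_, h⟩ rfl hle
          rw [hT'] at this
          exact hne (Fin.last_le_iff.1 this)
      · intro hlt heq
        exact Nat.find_min _ hlt (Or.inr ⟨h, heq⟩)
    · have h1 := hT.row_le hl (Fin.last k) j h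
      constructor
      · intro hne
        exact absurd (Fin.last_le_iff.1 (Fin.le_def.2 h1)) hne
      · intro hmem
        obtain ⟨i, hi, -⟩ := mem_cellsOf.1 hmem
        have := i.2
        simp only [Fin.val_last] at hi
        omega

theorem compatible_unique {k : ℕ} {l : Fin (k + 1) → ℕ}
    {T : cellsOf l → Fin (k + 1)} {ν ν' : Fin k → ℕ} (hν : ν ∈ interlacing l)
    (hν' : ν' ∈ interlacing l) (h : Compatible T ν) (h' : Compatible T ν') : ν = ν' := by
  apply cellsOf_injective
  ext a
  constructor
  · intro ha
    exact (h' ⟨a, cellsOf_subset_of_mem_interlacing hν ha⟩).1 ((h ⟨a, _⟩).2 ha)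
  · intro ha
    exact (h ⟨a, cellsOf_subset_of_mem_interlacing hν' ha⟩).1 ((h' ⟨a, _⟩).2 ha)

open Classical in
/-- The fillings whose letters other than the largest occupy the shape `ν`: such a filling is
determined by its restriction to `ν`. -/
theorem sum_compatible (x : ℕ → B) (t : ℤ → B) {k : ℕ} {l : Fin (k + 1) → ℕ} (hl : Antitone l)
    {ν : Fin k → ℕ} (hν : ν ∈ interlacing l) :
    (∑ T ∈ ((Finset.univ : Finset (cellsOf l → Fin (k + 1))).filter
        IsSemistandardOn).filter (Compatible · ν),
      ∏ a : cellsOf l, (x (T a) - t ((((T a : ℕ) : ℤ) + 1) + ((a.1.2 : ℤ) - (a.1.1 : ℤ))))) =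
    tableauSum x t k (cellsOf ν) * ∏ a ∈ cellsOf l \ cellsOf ν,
      (x k - t (((k : ℤ) + 1) + ((a.2 : ℤ) - (a.1 : ℤ)))) := by
  have hsub := cellsOf_subset_of_mem_interlacing hν
  rw [tableauSum, Finset.sum_mul]
  symm
  refine Finset.sum_bij'
    (fun T' _ => fun a => if h : a.1 ∈ cellsOf ν then (T' ⟨a.1, h⟩).castSucc else Fin.last k)
    (fun T hT => fun a => (T ⟨a.1, hsub a.2⟩).castPred
      (((Finset.mem_filter.1 hT).2 ⟨a.1, hsub a.2⟩).2 a.2)) ?_ ?_ ?_ ?_ ?_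
  · intro T' hT'
    have hT' := (Finset.mem_filter.1 hT').2
    refine Finset.mem_filter.2 ⟨Finset.mem_filter.2 ⟨Finset.mem_univ _, ?_, ?_⟩, ?_⟩
    · intro a b hab hle
      by_cases hb : b.1 ∈ cellsOf ν
      · have ha : a.1 ∈ cellsOf ν := by
          obtain ⟨i, hi, hj⟩ := mem_cellsOf.1 hb
          exact mem_cellsOf.2 ⟨i, hab.trans hi, hle.trans_lt hj⟩
        simp only [dif_pos ha, dif_pos hb]
        exact Fin.castSucc_le_castSucc_iff.2 (hT'.1 ⟨a.1, ha⟩ ⟨b.1, hb⟩ hab hle)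
      · simp only [dif_neg hb]
        exact Fin.le_last _
    · intro a b hab hlt
      have ha : a.1 ∈ cellsOf ν := by
        obtain ⟨i, hi, hj⟩ := mem_cellsOf.1 b.2
        have hi2 := i.2
        have ha' : a.1.1 < k := by omega
        refine mem_cellsOf.2 ⟨⟨a.1.1, ha'⟩, rfl, ?_⟩
        have h1 := ((mem_interlacing.1 hν) ⟨a.1.1, ha'⟩).1
        have h2 : l i ≤ l (Fin.succ ⟨a.1.1, ha'⟩) := by
          apply hl
          rw [Fin.le_def]
          simp only [Fin.succ_mk]
          omega
        omega
      by_cases hb : b.1 ∈ cellsOf ν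
      · simp only [dif_pos ha, dif_pos hb]
        exact Fin.castSucc_lt_castSucc_iff.2 (hT'.2 ⟨a.1, ha⟩ ⟨b.1, hb⟩ hab hlt)
      · simp only [dif_pos ha, dif_neg hb]
        exact Fin.castSucc_lt_last _
    · intro a
      by_cases ha : a.1 ∈ cellsOf ν
      · simp only [ha, iff_true]
        exact (Fin.castSucc_lt_last _).ne
      · simp [ha]
  · intro T hT
    have hT := (Finset.mem_filter.1 (Finset.mem_filter.1 hT).1).2
    refine Finset.mem_filter.2 ⟨Finset.mem_univ _, ?_, ?_⟩
    · intro a b hab hle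
      exact Fin.castPred_le_castPred_iff.2 (hT.1 ⟨a.1, hsub a.2⟩ ⟨b.1, hsub b.2⟩ hab hle)
    · intro a b hab hlt
      exact Fin.castPred_lt_castPred_iff.2 (hT.2 ⟨a.1, hsub a.2⟩ ⟨b.1, hsub b.2⟩ hab hlt)
  · intro T' hT'
    funext a
    simp
  · intro T hT
    funext a
    have hc := (Finset.mem_filter.1 hT).2 a
    by_cases ha : a.1 ∈ cellsOf ν
    · simp [ha]
    · simp only [dif_neg ha]
      by_contra hne
      exact ha (hc.1 (Ne.symm hne))
  · intro T' hT'
    -- both products are restrictions of one product over boxes, indexed by the extended filling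
    set E : ℕ × ℕ → ℕ := fun a => if h : a ∈ cellsOf ν then (T' ⟨a, h⟩ : ℕ) else k with hE
    set f : ℕ × ℕ → B := fun a =>
      x (E a) - t ((((E a : ℕ) : ℤ) + 1) + ((a.2 : ℤ) - (a.1 : ℤ))) with hf
    have h1 : ∀ a : cellsOf ν,
        x (T' a) - t ((((T' a : ℕ) : ℤ) + 1) + ((a.1.2 : ℤ) - (a.1.1 : ℤ))) = f a.1 := by
      intro a
      simp [hf, hE]
    have h2 : ∀ a ∈ cellsOf l \ cellsOf ν,
        x k - t (((k : ℤ) + 1) + ((a.2 : ℤ) - (a.1 : ℤ))) = f a := by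
      intro a ha
      simp [hf, hE, (Finset.mem_sdiff.1 ha).2]
    have h3 : ∀ a : cellsOf l, (((if h : a.1 ∈ cellsOf ν then (T' ⟨a.1, h⟩).castSucc
        else Fin.last k : Fin (k + 1)) : ℕ)) = E a.1 := by
      intro a
      by_cases ha : a.1 ∈ cellsOf ν <;> simp [hE, ha]
    rw [Finset.prod_congr rfl h2, Finset.prod_congr rfl fun a _ => h1 a]
    simp only [h3]
    rw [Finset.prod_coe_sort (cellsOf ν) f, Finset.prod_coe_sort (cellsOf l) f, mul_comm]
    exact Finset.prod_sdiff hsub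

/-- Branching rule: the boxes that carry the largest letter form a horizontal strip. -/
theorem tableauSum_succ (x : ℕ → B) (t : ℤ → B) {k : ℕ} {l : Fin (k + 1) → ℕ}
    (hl : Antitone l) :
    tableauSum x t (k + 1) (cellsOf l) =
      ∑ ν ∈ interlacing l, tableauSum x t k (cellsOf ν) *
        ∏ a ∈ cellsOf l \ cellsOf ν, (x k - t (((k : ℤ) + 1) + ((a.2 : ℤ) - (a.1 : ℤ)))) := by
  classical
  rw [← Finset.sum_congr rfl fun ν hν => sum_compatible x t hl hν, tableauSum,
    ← Finset.sum_biUnion]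
  · refine Finset.sum_congr ?_ fun _ _ => rfl
    ext T
    simp only [Finset.mem_biUnion, Finset.mem_filter, Finset.mem_univ, true_and]
    constructor
    · intro hT
      obtain ⟨ν, hν, hc⟩ := exists_compatible hl hT
      exact ⟨ν, hν, hT, hc⟩
    · rintro ⟨ν, -, hT, -⟩
      exact hT
  · intro ν hν ν' hν' hne
    refine Finset.disjoint_left.2 fun T hT hT' => hne ?_
    exact compatible_unique hν hν' (Finset.mem_filter.1 hT).2 (Finset.mem_filter.1 hT').2

/-- The product over the strip `l \ ν`, row by row; the last row of `l` belongs to the strip. -/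
theorem prod_cellsOf_sdiff {k : ℕ} {l : Fin (k + 1) → ℕ} (ν : Fin k → ℕ) (f : ℕ → ℕ → B) :
    ∏ a ∈ cellsOf l \ cellsOf ν, f a.1 a.2 =
      (∏ i : Fin k, ∏ j ∈ Finset.Ico (ν i) (l i.castSucc), f i j) *
        ∏ j ∈ Finset.range (l (Fin.last k)), f k j := by
  have key : ∏ a ∈ cellsOf l \ cellsOf ν, f a.1 a.2 =
      ∏ i : Fin (k + 1), ∏ j ∈ Finset.Ico ((Fin.snoc ν 0 : Fin (k + 1) → ℕ) i) (l i), f i j := by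
    rw [Finset.prod_sigma']
    symm
    refine Finset.prod_bij (fun p _ => ((p.1 : ℕ), p.2)) ?_ ?_ ?_ ?_
    · rintro ⟨i, j⟩ h
      simp only [Finset.mem_sigma, Finset.mem_univ, Finset.mem_Ico, true_and] at h
      refine Finset.mem_sdiff.2 ⟨mk_mem_cellsOf.2 h.2, fun hm => ?_⟩
      obtain ⟨i', hi, hj⟩ := mem_cellsOf.1 hm
      have : i = i'.castSucc := Fin.ext hi
      subst this
      rw [Fin.snoc_castSucc] at h
      exact absurd h.1 (not_le.2 hj)
    · rintro ⟨i, j⟩ _ ⟨i', j'⟩ _ h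
      simp only [Prod.mk.injEq] at h
      obtain ⟨h1, h2⟩ := h
      have := Fin.ext h1
      subst this h2
      rfl
    · rintro ⟨a, b⟩ h
      obtain ⟨h1, h2⟩ := Finset.mem_sdiff.1 h
      obtain ⟨i, hi, hj⟩ := mem_cellsOf.1 h1
      simp only at hi hj
      subst hi
      refine ⟨⟨i, b⟩, ?_, rfl⟩
      simp only [Finset.mem_sigma, Finset.mem_univ, Finset.mem_Ico, true_and]
      refine ⟨?_, hj⟩
      rcases Fin.eq_castSucc_or_eq_last i with ⟨i, rfl⟩ | rfl
      · rw [Fin.snoc_castSucc]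
        by_contra! hlt
        exact h2 (mem_cellsOf.2 ⟨i, rfl, hlt⟩)
      · rw [Fin.snoc_last]
        exact Nat.zero_le _
    · intros; rfl
  rw [key, Fin.prod_univ_castSucc]
  simp

end

/-! ### The bialternant formula -/

section

variable {B : Type*} [CommRing B]

/-- The factorial power `(y|t)^r = (y - t₁) ⋯ (y - t_r)`. -/
def facPow (t : ℤ → B) (y : B) (r : ℕ) : B := ∏ p ∈ Finset.range r, (y - t ((p : ℤ) + 1))

@[simp]
theorem facPow_zero (t : ℤ → B) (y : B) : facPow t y 0 = 1 := by simp [facPow]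

theorem facPow_succ (t : ℤ → B) (y : B) (r : ℕ) :
    facPow t y (r + 1) = facPow t y r * (y - t ((r : ℤ) + 1)) := by
  simp [facPow, Finset.prod_range_succ]

theorem facPow_mul_prod_Ico (t : ℤ → B) (y : B) {a b : ℕ} (h : a ≤ b) :
    facPow t y a * ∏ p ∈ Finset.Ico a b, (y - t ((p : ℤ) + 1)) = facPow t y b := by
  simp only [facPow, Finset.range_eq_Ico]
  exact Finset.prod_Ico_consecutive _ (Nat.zero_le _) h

/-- The telescoping sum behind the branching rule. -/
theorem sub_mul_sum_facPow (t : ℤ → B) (u y : B) {a b : ℕ} (h : a ≤ b) :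
    (u - y) * ∑ r ∈ Finset.Ico a b,
        facPow t u r * ∏ p ∈ Finset.Ico (r + 1) b, (y - t ((p : ℤ) + 1)) =
      facPow t u b - facPow t u a * ∏ p ∈ Finset.Ico a b, (y - t ((p : ℤ) + 1)) := by
  induction b, h using Nat.le_induction with
  | base => simp
  | succ b hab ih =>
    have h1 : ∀ r ∈ Finset.Ico a b,
        facPow t u r * ∏ p ∈ Finset.Ico (r + 1) (b + 1), (y - t ((p : ℤ) + 1)) =
        (facPow t u r * ∏ p ∈ Finset.Ico (r + 1) b, (y - t ((p : ℤ) + 1))) *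
          (y - t ((b : ℤ) + 1)) := by
      intro r hr
      rw [Finset.prod_Ico_succ_top (Finset.mem_Ico.1 hr).2, mul_assoc]
    rw [Finset.sum_Ico_succ_top hab, Finset.sum_congr rfl h1, ← Finset.sum_mul, mul_add,
      ← mul_assoc, ih, Finset.prod_Ico_succ_top hab, facPow_succ]
    simp only [Finset.Ico_self, Finset.prod_empty]
    ring

/-- Elimination of the last variable from the determinant of factorial powers. -/
theorem det_facPow_succ (x : ℕ → B) (t : ℤ → B) {k : ℕ} {b : Fin (k + 1) → ℕ}
    (hb : Monotone b) :
    (Matrix.of fun i j : Fin (k + 1) => facPow t (x i) (b j)).det =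
      (-1) ^ k * facPow t (x k) (b 0) * ((∏ i : Fin k, (x i - x k)) *
        (Matrix.of fun i j : Fin k => ∑ r ∈ Finset.Ico (b j.castSucc) (b j.succ),
          facPow t (x i) r *
            ∏ p ∈ Finset.Ico (r + 1) (b j.succ), (x k - t ((p : ℤ) + 1))).det) := by
  set Q : Fin k → B := fun j =>
    ∏ p ∈ Finset.Ico (b j.castSucc) (b j.succ), (x k - t ((p : ℤ) + 1)) with hQ
  set A : Matrix (Fin (k + 1)) (Fin (k + 1)) B :=
    Matrix.of fun i j : Fin (k + 1) => facPow t (x i) (b j) with hA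
  set M : Matrix (Fin (k + 1)) (Fin (k + 1)) B := Matrix.of fun i j : Fin (k + 1) =>
    Fin.cases (motive := fun _ => B) (A i 0) (fun j => A i j.succ - Q j * A i j.castSucc) j with hM
  have hle : ∀ j : Fin k, b j.castSucc ≤ b j.succ := fun j => hb (Fin.castSucc_lt_succ).le
  have h1 : A.det = M.det := by
    refine Matrix.det_eq_of_forall_col_eq_smul_add_pred Q (fun i => ?_) (fun i j => ?_)
    · simp [hM]
    · simp [hM]
  rw [h1, Matrix.det_succ_row M (Fin.last k), Finset.sum_eq_single (0 : Fin (k + 1))]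
  · rw [← Matrix.det_mul_column]
    congr 2
    ext i j
    have := sub_mul_sum_facPow t (x i) (x k) (hle j)
    simp only [Matrix.of_apply, this]
    simp [hM, hA, hQ, mul_comm]
  · intro j _ hj
    obtain ⟨j, rfl⟩ := Fin.exists_succ_eq.2 hj
    have : M (Fin.last k) j.succ = 0 := by
      simp only [hM, hA, hQ, Matrix.of_apply, Fin.cases_succ, Fin.val_last]
      rw [mul_comm, facPow_mul_prod_Ico t (x k) (hle j), sub_self]
    rw [this]
    ring
  · simp

/-- The Vandermonde determinant, written in the basis of factorial powers. -/
def facVandermonde (x : ℕ → B) (t : ℤ → B) (k : ℕ) : B :=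
  (Matrix.of fun i j : Fin k => facPow t (x i) j).det

theorem facVandermonde_succ (x : ℕ → B) (t : ℤ → B) (k : ℕ) :
    facVandermonde x t (k + 1) =
      (-1) ^ k * ((∏ i : Fin k, (x i - x k)) * facVandermonde x t k) := by
  rw [facVandermonde, det_facPow_succ x t (b := fun j => (j : ℕ)) (fun _ _ h => h)]
  simp [facVandermonde]

theorem facVandermonde_ne_zero [IsDomain B] (x : ℕ → B) (t : ℤ → B) (k : ℕ)
    (hx : ∀ i < k, ∀ j < k, x i = x j → i = j) : facVandermonde x t k ≠ 0 := by
  induction k with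
  | zero => simp [facVandermonde]
  | succ k ih =>
    rw [facVandermonde_succ]
    refine mul_ne_zero (by simp) (mul_ne_zero (Finset.prod_ne_zero_iff.2 fun i _ h => ?_)
      (ih fun i hi j hj h => hx i (by omega) j (by omega) h))
    have := hx i (by omega) k (by omega) (sub_eq_zero.1 h)
    omega

/-- Expansion of a determinant whose columns are linear combinations. -/
theorem det_sum_mul {k : ℕ} {ι : Type*} [DecidableEq ι] (s : Fin k → Finset ι)
    (g : Fin k → ι → Fin k → B) (c : Fin k → ι → B) :
    (Matrix.of fun i j : Fin k => ∑ r ∈ s j, g j r i * c j r).det =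
      ∑ ν ∈ Fintype.piFinset s,
        (Matrix.of fun i j : Fin k => g j (ν j) i).det * ∏ j, c j (ν j) := by
  rw [← Matrix.det_transpose]
  have h1 : (Matrix.of fun i j : Fin k => ∑ r ∈ s j, g j r i * c j r).transpose =
      (fun j => ∑ r ∈ s j, (fun i => g j r i * c j r)) := by
    ext i j
    simp [Matrix.transpose_apply]
  rw [h1]
  have h2 := (Matrix.detRowAlternating (n := Fin k) (R := B)).toMultilinearMap.map_sum_finset
    (A := s) (g := fun j r => fun i => g j r i * c j r)
  refine h2.trans (Finset.sum_congr rfl fun ν _ => ?_)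
  rw [← Matrix.det_transpose (Matrix.of _), mul_comm, ← Matrix.det_mul_column]
  change Matrix.det _ = _
  congr 1
  ext i j
  simp [mul_comm]

/-- The bialternant formula: the factorial Schur polynomial of a diagram with at most `k` rows is a
ratio of determinants of factorial powers. The columns are listed by increasing exponent, that is,
from the last row of the diagram to the first. -/
theorem tableauSum_mul_facVandermonde (x : ℕ → B) (t : ℤ → B) {k : ℕ} {l : Fin k → ℕ}
    (hl : Antitone l) :
    tableauSum x t k (cellsOf l) * facVandermonde x t k =
      (Matrix.of fun i j : Fin k => facPow t (x i) (l j.rev + j)).det := by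
  induction k with
  | zero =>
    have : cellsOf l = ∅ := rfl
    rw [this]
    have hss : ∀ T : (∅ : Finset (ℕ × ℕ)) → Fin 0, IsSemistandardOn T :=
      fun T => by simp [IsSemistandardOn]
    simp [facVandermonde, tableauSum, hss]
  | succ k ih =>
    have hb : Monotone fun j : Fin (k + 1) => l j.rev + j := fun i j hij =>
      add_le_add (hl (Fin.rev_le_rev.2 hij)) hij
    rw [tableauSum_succ x t hl, facVandermonde_succ, det_facPow_succ x t hb]
    set y := x k
    -- each column of the reduced determinant is a sum over one part of an interlacing shape
    have hcol : ∀ i j : Fin k, (∑ r ∈ Finset.Ico (l j.castSucc.rev + (j.castSucc : ℕ))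
          (l j.succ.rev + (j.succ : ℕ)), facPow t (x i) r *
            ∏ p ∈ Finset.Ico (r + 1) (l j.succ.rev + (j.succ : ℕ)), (y - t ((p : ℤ) + 1))) =
        ∑ r ∈ Finset.Icc (l j.rev.succ) (l j.rev.castSucc), facPow t (x i) (r + j) *
          ∏ m ∈ Finset.Ico r (l j.rev.castSucc),
            (y - t (((k : ℤ) + 1) + ((m : ℤ) - (j.rev : ℕ)))) := by
      intro i j
      have hjk := j.2
      rw [Fin.rev_castSucc, Fin.rev_succ]
      refine (Finset.sum_nbij' (fun r : ℕ => r + (j : ℕ)) (fun r : ℕ => r - (j : ℕ)) ?_ ?_ ?_ ?_ ?_).symm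
      · intro r hr
        simp only [Finset.mem_Icc, Finset.mem_Ico, Fin.val_castSucc, Fin.val_succ] at hr ⊢
        omega
      · intro r hr
        simp only [Finset.mem_Icc, Finset.mem_Ico, Fin.val_castSucc, Fin.val_succ] at hr ⊢
        omega
      · intro r hr
        simp
      · intro r hr
        simp only [Finset.mem_Ico, Fin.val_castSucc] at hr
        omega
      · intro r hr
        congr 1
        refine Finset.prod_nbij' (fun m : ℕ => m + (j : ℕ) + 1) (fun p : ℕ => p - (j : ℕ) - 1) ?_ ?_ ?_ ?_ ?_
        · intro m hm
          simp only [Finset.mem_Ico, Fin.val_succ] at hm ⊢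
          omega
        · intro m hm
          simp only [Finset.mem_Ico, Fin.val_succ] at hm ⊢
          omega
        · intro m hm
          omega
        · intro m hm
          simp only [Finset.mem_Ico, Fin.val_succ] at hm ⊢
          omega
        · intro m hm
          congr 2
          rw [Fin.val_rev]
          push_cast [Nat.cast_sub (show (j : ℕ) + 1 ≤ k by omega)]
          ring
    simp only [hcol]
    rw [det_sum_mul (fun j : Fin k => Finset.Icc (l j.rev.succ) (l j.rev.castSucc))
      (fun j r i => facPow t (x i) (r + j))
      (fun j r => ∏ m ∈ Finset.Ico r (l j.rev.castSucc),
            (y - t (((k : ℤ) + 1) + ((m : ℤ) - (j.rev : ℕ)))))]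
    have hsum : (∑ ν ∈ interlacing l, (tableauSum x t k (cellsOf ν) *
          ∏ a ∈ cellsOf l \ cellsOf ν, (y - t (((k : ℤ) + 1) + ((a.2 : ℤ) - (a.1 : ℤ))))) *
          facVandermonde x t k) =
        facPow t y (l (Fin.last k)) *
        ∑ ν ∈ Fintype.piFinset fun j : Fin k => Finset.Icc (l j.rev.succ) (l j.rev.castSucc),
          (Matrix.of fun i j : Fin k => facPow t (x i) (ν j + j)).det *
            ∏ j : Fin k, ∏ m ∈ Finset.Ico (ν j) (l j.rev.castSucc),
              (y - t (((k : ℤ) + 1) + ((m : ℤ) - (j.rev : ℕ)))) := by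
      rw [Finset.mul_sum]
      refine Finset.sum_nbij' (fun ν => fun j => ν j.rev) (fun ν => fun j => ν j.rev)
        ?_ ?_ ?_ ?_ ?_
      · intro ν hν
        rw [mem_interlacing] at hν
        rw [Fintype.mem_piFinset]
        exact fun j => Finset.mem_Icc.2 (hν j.rev)
      · intro ν hν
        rw [Fintype.mem_piFinset] at hν
        rw [mem_interlacing]
        intro j
        simpa using hν j.rev
      · intro ν hν; simp
      · intro ν hν; simp
      · intro ν hν
        rw [mul_right_comm, ih (antitone_of_mem_interlacing hl hν),
          prod_cellsOf_sdiff ν fun i j => (y - t (((k : ℤ) + 1) + ((j : ℤ) - (i : ℤ))))]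
        have e1 : (∏ j ∈ Finset.range (l (Fin.last k)),
            (y - t (((k : ℤ) + 1) + ((j : ℤ) - (k : ℤ))))) = facPow t y (l (Fin.last k)) := by
          refine Finset.prod_congr rfl fun j _ => ?_
          congr 2
          ring
        rw [e1, ← Equiv.prod_comp Fin.revPerm]
        simp only [Fin.revPerm_apply]
        ring
    have hzero : l (Fin.rev (0 : Fin (k + 1))) + ((0 : Fin (k + 1)) : ℕ) = l (Fin.last k) := by
      simp
    rw [hzero]
    rw [← Finset.sum_mul] at hsum
    linear_combination ((-1) ^ k * ∏ i : Fin k, (x i - y)) * hsum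

end

/-! ### Determinants of residues modulo a monic polynomial -/

section

open Polynomial

theorem map_facPow {B B' : Type*} [CommRing B] [CommRing B'] (f : B →+* B') (t : ℤ → B) (y : B)
    (r : ℕ) : f (facPow t y r) = facPow (fun i => f (t i)) (f y) r := by
  simp [facPow, map_prod]

theorem facPow_add_period {B : Type*} [CommRing B] {t : ℤ → B} {n : ℕ}
    (ht : ∀ i, t (i + n) = t i) (y : B) (r : ℕ) :
    facPow t y (n + r) = facPow t y n * facPow t y r := by
  rw [facPow, Finset.prod_range_add]
  refine congrArg _ (Finset.prod_congr rfl fun i _ => ?_)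
  rw [← ht ((i : ℤ) + 1)]
  congr 2
  push_cast
  ring

variable {K : Type*} [CommRing K]

/-- The factorial power `(y|t)^r` as a polynomial in `y`. -/
def facPoly (t : ℤ → K) (r : ℕ) : K[X] := facPow (fun i => C (t i)) X r

theorem facPoly_monic (t : ℤ → K) (r : ℕ) : (facPoly t r).Monic := by
  unfold facPoly facPow
  exact monic_prod_of_monic _ _ fun _ _ => monic_X_sub_C _

theorem natDegree_facPoly [Nontrivial K] (t : ℤ → K) (r : ℕ) : (facPoly t r).natDegree = r := by
  rw [facPoly, facPow, natDegree_prod_of_monic _ _ fun _ _ => monic_X_sub_C _]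
  simp

theorem coeff_facPoly_self (t : ℤ → K) (r : ℕ) : (facPoly t r).coeff r = 1 := by
  nontriviality K
  have h := (facPoly_monic t r).coeff_natDegree
  rwa [natDegree_facPoly] at h

theorem map_facPoly {S : Type*} [CommRing S] (φ : K →+* S) (t : ℤ → K) (r : ℕ) :
    (facPoly t r).map φ = facPoly (fun i => φ (t i)) r := by
  have := map_facPow (mapRingHom φ) (fun i => C (t i)) X r
  simpa [facPoly] using this

theorem eval₂_facPoly {S : Type*} [CommRing S] (φ : K →+* S) (y : S) (t : ℤ → K) (r : ℕ) :
    (facPoly t r).eval₂ φ y = facPow (fun i => φ (t i)) y r := by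
  have := map_facPow (eval₂RingHom φ y) (fun i => C (t i)) X r
  simpa [facPoly] using this

/-- The determinant of the coordinates of the residues of `p 0, …, p (k - 1)` modulo a monic
polynomial `G` of degree `k`, in the basis `y^(k-1), …, y, 1` of `K[y] / G`. -/
def residueDet {k : ℕ} (G : K[X]) (p : Fin k → K[X]) : K :=
  (Matrix.of fun m j : Fin k => (p j %ₘ G).coeff (m.rev : ℕ)).det

theorem map_residueDet {S : Type*} [CommRing S] (φ : K →+* S) {k : ℕ} {G : K[X]} (hG : G.Monic)
    (p : Fin k → K[X]) : φ (residueDet G p) = residueDet (G.map φ) fun j => (p j).map φ := by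
  rw [residueDet, residueDet, RingHom.map_det]
  congr 1
  ext m j
  simp [← map_modByMonic φ hG]

/-- If every `x i` is a root of `G`, the determinant of the values `p j (x i)` is that of the
residues times a Vandermonde determinant. -/
theorem det_eval₂_eq {S : Type*} [CommRing S] (φ : K →+* S) {k : ℕ} {G : K[X]}
    (hG : G.Monic) (hk : G.natDegree = k) (x : Fin k → S) (hx : ∀ i, G.eval₂ φ (x i) = 0)
    (p : Fin k → K[X]) :
    (Matrix.of fun i j : Fin k => (p j).eval₂ φ (x i)).det =
      (Matrix.of fun i m : Fin k => x i ^ (m.rev : ℕ)).det * φ (residueDet G p) := by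
  rw [residueDet, RingHom.map_det, ← Matrix.det_mul]
  congr 1
  ext i j
  have hk0 : 0 < k := (Nat.zero_le _).trans_lt i.2
  have hlt : (p j %ₘ G).natDegree < k := by
    rw [← hk]
    refine natDegree_modByMonic_lt _ hG fun h => ?_
    rw [h, natDegree_one] at hk
    omega
  rw [Matrix.of_apply, Matrix.mul_apply, ← eval₂_modByMonic_eq_self_of_root (hx i),
    eval₂_eq_sum_range' φ hlt, ← Fin.sum_univ_eq_sum_range
      (fun m => φ ((p j %ₘ G).coeff m) * x i ^ m), ← Equiv.sum_comp Fin.revPerm]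
  refine Finset.sum_congr rfl fun m _ => ?_
  simp [mul_comm]

/-- When all but the first residue form the standard unitriangular system, only the top coordinate
of the first one matters. -/
theorem residueDet_of_monic [Nontrivial K] {k : ℕ} {G : K[X]} (hG : G.Monic)
    (hk : G.natDegree = k + 1) (p : Fin (k + 1) → K[X])
    (hp : ∀ j : Fin k, (p j.succ).Monic ∧ (p j.succ).natDegree = (j.succ.rev : ℕ)) :
    residueDet G p = (p 0 %ₘ G).coeff k := by
  have hself : ∀ j : Fin k, p j.succ %ₘ G = p j.succ := by
    intro j
    refine (modByMonic_eq_self_iff hG).2 (degree_lt_degree ?_)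
    rw [(hp j).2, hk]
    exact (Fin.rev _).2
  rw [residueDet, Matrix.det_of_isLowerTriangular, Fin.prod_univ_succ]
  · rw [Finset.prod_eq_one, mul_one]
    · simp
    · intro j _
      rw [Matrix.of_apply, hself, ← (hp j).2]
      exact (hp j).1.coeff_natDegree
  · intro m j hmj
    have hmj : m < j := hmj
    obtain ⟨j, rfl⟩ := Fin.exists_succ_eq.2 ((Fin.zero_le m).trans_lt hmj).ne'
    rw [Matrix.of_apply, hself]
    refine coeff_eq_zero_of_natDegree_lt ?_
    rw [(hp j).2]
    exact Fin.rev_lt_rev.2 hmj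

/-- The pairing `(f, g) ↦ top coordinate of f g` on `K[y] / G` is nondegenerate: it is enough to
test `f` against one monic polynomial of each degree below that of `G`. -/
theorem modByMonic_eq_zero_of_coeff {k : ℕ} {G : K[X]} (hG : G.Monic)
    (hk : G.natDegree = k + 1) (b : ℕ → K[X]) (hb : ∀ i, (b i).Monic)
    (hbd : ∀ i, (b i).natDegree = i) (f : K[X])
    (hf : ∀ i ≤ k, ((f * b i) %ₘ G).coeff k = 0) : f %ₘ G = 0 := by
  nontriviality K
  by_contra hne
  set g := f %ₘ G with hg
  have hd : g.natDegree < k + 1 := by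
    rw [← hk]
    refine natDegree_modByMonic_lt _ hG fun h => ?_
    rw [h, natDegree_one] at hk
    omega
  set b' := b (k - g.natDegree)
  have hdeg : (g * b').natDegree = k := by
    rw [mul_comm, (hb _).natDegree_mul' hne, hbd]
    omega
  have hself : (g * b') %ₘ G = g * b' := by
    refine (modByMonic_eq_self_iff hG).2 (degree_lt_degree ?_)
    omega
  have hmod : (f * b') %ₘ G = g * b' := by
    rw [← hself, mul_modByMonic f b', mul_modByMonic g b', hg,
      (modByMonic_eq_self_iff hG).2 (degree_modByMonic_lt f hG)]
  have h0 := hf (k - g.natDegree) (Nat.sub_le _ _)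
  rw [hmod, ← hdeg, coeff_natDegree, leadingCoeff_mul_monic (hb _)] at h0
  exact hne (leadingCoeff_eq_zero.1 h0)

/-- Replacing one residue by a scalar multiple of another polynomial. -/
theorem residueDet_update_smul {k : ℕ} {G : K[X]} (p : Fin k → K[X]) (i : Fin k) (c : K)
    (u : K[X]) (h : p i %ₘ G = c • (u %ₘ G)) :
    residueDet G p = c * residueDet G (Function.update p i u) := by
  rw [residueDet, residueDet]
  set M := Matrix.of fun m j : Fin k => (p j %ₘ G).coeff (m.rev : ℕ) with hM
  have h1 : (Matrix.of fun m j : Fin k =>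
      ((Function.update p i u) j %ₘ G).coeff (m.rev : ℕ)) =
      M.updateCol i fun m => (u %ₘ G).coeff (m.rev : ℕ) := by
    ext m j
    rcases eq_or_ne j i with rfl | hj
    · simp
    · simp [hj, hM]
  have h2 : M = M.updateCol i (c • fun m : Fin k => (u %ₘ G).coeff (m.rev : ℕ)) := by
    ext m j
    rcases eq_or_ne j i with rfl | hj
    · simp [hM, h]
    · simp [hj]
  rw [h1, ← Matrix.det_updateCol_smul, ← h2]

theorem residueDet_eq_zero_of_eq {k : ℕ} {G : K[X]} (p : Fin k → K[X]) {i j : Fin k}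
    (hij : i ≠ j) (h : p i = p j) : residueDet G p = 0 :=
  Matrix.det_zero_of_column_eq hij fun m => by simp [h]

theorem residueDet_comp_perm {k : ℕ} {G : K[X]} (p : Fin k → K[X]) (σ : Equiv.Perm (Fin k)) :
    residueDet G (p ∘ σ) = Equiv.Perm.sign σ * residueDet G p :=
  Matrix.det_permute' σ (Matrix.of fun m j => (p j %ₘ G).coeff (m.rev : ℕ))

end

/-! ### The factorial Schur polynomials as ratios of determinants -/

section

open Polynomial

instance (n : ℕ) : IsDomain (QWeights n) := inferInstanceAs (IsDomain (Polynomial (Weights n)))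

theorem tWeight_add_period (n : ℕ) (i : ℤ) : tWeight n (i + n) = tWeight n i := by
  have h : ((i + n : ℤ) : ZMod n) = (i : ZMod n) := by simp
  rw [tWeight, h, tWeight]

/-- The variables of `Λ[q][x₁, …, x_k]`, counted from `0` and extended by zero. -/
def xVar (k n : ℕ) (i : ℕ) : XPoly k n := if h : i < k then MvPolynomial.X ⟨i, h⟩ else 0

/-- The torus weights as constants of `Λ[q][x₁, …, x_k]`. -/
def tVar (k n : ℕ) (i : ℤ) : XPoly k n := MvPolynomial.C (tWeight n i)

@[simp]
theorem xVar_fin {k n : ℕ} (i : Fin k) : xVar k n i = MvPolynomial.X i := by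
  simp [xVar]

theorem factorialSchur_eq_tableauSum (k n : ℕ) (μ : YoungDiagram) :
    factorialSchur k n μ = tableauSum (xVar k n) (tVar k n) k μ.cells := by
  simp only [tableauSum, xVar_fin]
  rfl

theorem cells_eq_cellsOf {k : ℕ} {μ : YoungDiagram} (hμ : μ.rowLen k = 0) :
    μ.cells = cellsOf fun i : Fin k => μ.rowLen i := by
  ext ⟨i, j⟩
  rw [YoungDiagram.mem_cells, YoungDiagram.mem_iff_lt_rowLen, mem_cellsOf]
  constructor
  · intro h
    have hik : i < k := by
      by_contra! hki
      have := μ.rowLen_anti k i hki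
      omega
    exact ⟨⟨i, hik⟩, rfl, h⟩
  · rintro ⟨i', hi, hj⟩
    simp only at hi hj
    rwa [hi]

/-- A column with more than `k` boxes has no strictly increasing filling by `k` letters. -/
theorem factorialSchur_eq_zero {k n : ℕ} {μ : YoungDiagram} (hμ : 0 < μ.rowLen k) :
    factorialSchur k n μ = 0 := by
  classical
  rw [factorialSchur, Finset.filter_false_of_mem, Finset.sum_empty]
  intro T _ hT
  have hmem : ∀ i : Fin (k + 1), ((i : ℕ), 0) ∈ μ.cells := fun i => by
    rw [YoungDiagram.mem_cells, YoungDiagram.mem_iff_lt_rowLen]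
    exact hμ.trans_le (μ.rowLen_anti _ _ (Nat.lt_succ_iff.1 i.2))
  have hmono : StrictMono fun i : Fin (k + 1) => T ⟨_, hmem i⟩ :=
    fun i j hij => hT.2 _ _ rfl hij
  have := Fintype.card_le_of_injective _ hmono.injective
  simp at this

theorem facVandermonde_xVar_ne_zero (k n : ℕ) :
    facVandermonde (xVar k n) (tVar k n) k ≠ 0 := by
  refine facVandermonde_ne_zero _ _ _ fun i hi j hj h => ?_
  have h' : (MvPolynomial.X ⟨i, hi⟩ : XPoly k n) = MvPolynomial.X ⟨j, hj⟩ := by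
    simpa [xVar, hi, hj] using h
  exact congrArg Fin.val (MvPolynomial.X_injective h')

theorem factorialSchur_mul_facVandermonde {k n : ℕ} {μ : YoungDiagram} (hμ : μ.rowLen k = 0) :
    factorialSchur k n μ * facVandermonde (xVar k n) (tVar k n) k =
      (Matrix.of fun i j : Fin k =>
        facPow (tVar k n) (xVar k n i) (μ.rowLen (j.rev : ℕ) + j)).det := by
  rw [factorialSchur_eq_tableauSum, cells_eq_cellsOf hμ, tableauSum_mul_facVandermonde]
  exact fun i j hij => μ.rowLen_anti _ _ hij

theorem rowLen_colShape (m i : ℕ) : (colShape m).rowLen i = if i < m then 1 else 0 := by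
  refine eq_of_forall_lt_iff fun j => ?_
  rw [← YoungDiagram.mem_iff_lt_rowLen, colShape, YoungDiagram.mem_ofRowLens]
  by_cases h : i < m <;> simp [h]

theorem rowLen_rowShape (m i : ℕ) : (rowShape m).rowLen i = if i = 0 then m else 0 := by
  refine eq_of_forall_lt_iff fun j => ?_
  rw [← YoungDiagram.mem_iff_lt_rowLen, rowShape, YoungDiagram.mem_ofRowLens]
  by_cases h : i = 0 <;> simp [h]

theorem factorialE_mem_symRing {k n m : ℕ} (h1 : 1 ≤ m) (h2 : m ≤ k) :
    factorialE k n m ∈ SymRing k n :=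
  Algebra.subset_adjoin ⟨m, h1, h2, rfl⟩

/-- The determinants of `k` of the first `k + 1` factorial powers are the factorial elementary
polynomials times the Vandermonde determinant. -/
theorem exists_symRing_mul_facVandermonde (k n : ℕ) (j : Fin (k + 1)) :
    ∃ e : SymRing k n, (e : XPoly k n) * facVandermonde (xVar k n) (tVar k n) k =
      (Matrix.of fun i m : Fin k =>
        facPow (tVar k n) (xVar k n i) (j.succAbove m : ℕ)).det := by
  rcases Fin.eq_castSucc_or_eq_last j with ⟨j, rfl⟩ | rfl
  · have hj := j.2
    refine ⟨⟨_, factorialE_mem_symRing (m := k - j) (by omega) (by omega)⟩, ?_⟩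
    have h0 : (colShape (k - j)).rowLen k = 0 := by
      rw [rowLen_colShape, if_neg (by omega)]
    refine (factorialSchur_mul_facVandermonde h0).trans ?_
    congr 1
    ext i m
    have hm := m.2
    rw [Matrix.of_apply, Matrix.of_apply, rowLen_colShape, Fin.val_rev]
    congr 1
    by_cases h : (m : ℕ) < j
    · rw [if_neg (by omega), Fin.succAbove_of_castSucc_lt _ _ (Fin.castSucc_lt_castSucc_iff.2 h)]
      simp
    · rw [if_pos (by omega), Fin.succAbove_of_le_castSucc _ _
        (Fin.castSucc_le_castSucc_iff.2 (not_lt.1 h))]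
      simp [add_comm]
  · refine ⟨1, ?_⟩
    simp [facVandermonde]

/-- The inclusion of `Λ[q, e₁(x|t), …, e_k(x|t)]` in `Λ[q][x₁, …, x_k]`. -/
def symVal (k n : ℕ) : SymRing k n →+* XPoly k n := (SymRing k n).val

theorem symVal_apply {k n : ℕ} (f : SymRing k n) : symVal k n f = f := rfl

theorem symVal_injective (k n : ℕ) : Function.Injective (symVal k n) := Subtype.val_injective

/-- The torus weights in `Λ[q, e₁(x|t), …, e_k(x|t)]`. -/
def tSym (k n : ℕ) (i : ℤ) : SymRing k n := algebraMap (QWeights n) (SymRing k n) (tWeight n i)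

theorem tSym_add_period (k n : ℕ) (i : ℤ) : tSym k n (i + n) = tSym k n i := by
  simp [tSym, tWeight_add_period]

theorem symVal_tSym (k n : ℕ) : (fun i => symVal k n (tSym k n i)) = tVar k n := rfl

/-- The polynomial `∏ (y - x_i)` has coefficients in `Λ[q, e₁(x|t), …, e_k(x|t)]`: expand the
Vandermonde determinant in `x₁, …, x_k, y`, written in factorial powers, along the row of `y`. -/
theorem exists_map_eq_prod (k n : ℕ) :
    ∃ G : (SymRing k n)[X], G.map (symVal k n) =
      ∏ i : Fin k, (X - C (MvPolynomial.X i : XPoly k n)) := by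
  choose e he using exists_symRing_mul_facVandermonde k n
  refine ⟨∑ j : Fin (k + 1), (-1) ^ (k + j : ℕ) * facPoly (tSym k n) j * C (e j), ?_⟩
  set Δ := facVandermonde (xVar k n) (tVar k n) k with hΔ
  have hΔ0 : (C Δ : (XPoly k n)[X]) ≠ 0 := C_ne_zero.2 (facVandermonde_xVar_ne_zero k n)
  refine mul_right_cancel₀ hΔ0 ?_
  set x' : ℕ → (XPoly k n)[X] := fun i => if i < k then C (xVar k n i) else X with hx'
  set t' : ℤ → (XPoly k n)[X] := fun i => C (tVar k n i) with ht'
  have hxk : x' k = X := by simp [hx']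
  have hxi : ∀ i : Fin k, x' i = C (xVar k n i) := fun i => by simp [hx']
  have hpow : ∀ (i : Fin k) (r : ℕ), facPow t' (x' i) r =
      C (facPow (tVar k n) (xVar k n i) r) := fun i r => by
    rw [hxi, map_facPow]
  have h1 : facVandermonde x' t' (k + 1) =
      (∏ i : Fin k, (X - C (MvPolynomial.X i : XPoly k n))) * C Δ := by
    rw [facVandermonde_succ, ← mul_assoc]
    congr 1
    · have hneg := Finset.prod_neg (s := Finset.univ) fun i : Fin k => x' i - X
      rw [Finset.card_univ, Fintype.card_fin] at hneg
      rw [hxk, ← hneg]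
      simp [hxi]
    · rw [hΔ, facVandermonde, facVandermonde, RingHom.map_det]
      congr 1
      ext1 i j
      simp [hpow]
  rw [← h1, facVandermonde, Matrix.det_succ_row _ (Fin.last k), Polynomial.map_sum,
    Finset.sum_mul]
  refine Finset.sum_congr rfl fun j _ => ?_
  have h2 : (Matrix.submatrix (Matrix.of fun i j : Fin (k + 1) => facPow t' (x' i) j)
      (Fin.last k).succAbove j.succAbove).det = C ((e j : XPoly k n) * Δ) := by
    rw [he, RingHom.map_det]
    congr 1
    ext1 i m
    simp [hpow]
  rw [h2, Polynomial.map_mul, Polynomial.map_mul, map_facPoly, symVal_tSym, map_C, symVal_apply]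
  simp [hxk, facPoly, ht', mul_assoc]

end

/-! ### Lifting to the ring generated by the elementary polynomials -/

section

open Polynomial

/-- The polynomial `∏ (y - x_i)` over `Λ[q, e₁(x|t), …, e_k(x|t)]`. -/
def rootPoly (k n : ℕ) : (SymRing k n)[X] := (exists_map_eq_prod k n).choose

theorem map_rootPoly (k n : ℕ) : (rootPoly k n).map (symVal k n) =
    ∏ i : Fin k, (X - C (MvPolynomial.X i : XPoly k n)) :=
  (exists_map_eq_prod k n).choose_spec

theorem rootPoly_monic (k n : ℕ) : (rootPoly k n).Monic := by
  rw [(symVal_injective k n).monic_map_iff, map_rootPoly]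
  exact monic_prod_X_sub_C _ _

theorem natDegree_rootPoly (k n : ℕ) : (rootPoly k n).natDegree = k := by
  rw [← natDegree_map_eq_of_injective (symVal_injective k n), map_rootPoly,
    natDegree_prod_of_monic _ _ fun _ _ => monic_X_sub_C _]
  simp

theorem eval₂_rootPoly {k n : ℕ} (i : Fin k) :
    (rootPoly k n).eval₂ (symVal k n) (xVar k n i) = 0 := by
  rw [eval₂_eq_eval_map, map_rootPoly, eval_prod]
  exact Finset.prod_eq_zero (Finset.mem_univ i) (by simp)

/-- The exponents `λ_j + k - j` of the bialternant formula, in decreasing order (`j` counts from `0`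
in the code, so `k - j` becomes `j.rev = k - 1 - j`). -/
def betaNumber (k : ℕ) (μ : YoungDiagram) (j : Fin k) : ℕ := μ.rowLen j + (j.rev : ℕ)

/-- The factorial Schur polynomial as an element of `Λ[q, e₁(x|t), …, e_k(x|t)]`; it vanishes when `μ`
has more than `k` rows. -/
def schurSym (k n : ℕ) (μ : YoungDiagram) : SymRing k n :=
  if μ.rowLen k = 0 then
    residueDet (rootPoly k n) fun j : Fin k => facPoly (tSym k n) (betaNumber k μ j)
  else 0

theorem det_facPow_xVar {k n : ℕ} (b : Fin k → ℕ) :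
    (Matrix.of fun i j : Fin k => facPow (tVar k n) (xVar k n i) (b j)).det =
      (Matrix.of fun i m : Fin k => xVar k n i ^ (m.rev : ℕ)).det *
        symVal k n (residueDet (rootPoly k n) fun j => facPoly (tSym k n) (b j)) := by
  rw [← det_eval₂_eq (symVal k n) (rootPoly_monic k n) (natDegree_rootPoly k n)
    (fun i : Fin k => xVar k n i) eval₂_rootPoly]
  simp only [eval₂_facPoly, symVal_tSym]

/-- Reversing the order of the columns. -/
theorem det_facPow_rev {k n : ℕ} (b : Fin k → ℕ) :
    (Matrix.of fun i j : Fin k => facPow (tVar k n) (xVar k n i) (b j.rev)).det =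
      (Equiv.Perm.sign (Fin.revPerm (n := k)) : XPoly k n) *
        (Matrix.of fun i j : Fin k => facPow (tVar k n) (xVar k n i) (b j)).det :=
  Matrix.det_permute' Fin.revPerm
    (Matrix.of fun i j : Fin k => facPow (tVar k n) (xVar k n i) (b j))

theorem residueDet_facPoly_rev {k n : ℕ} (hk : 0 < k) :
    (residueDet (rootPoly k n) fun j : Fin k => facPoly (tSym k n) (j.rev : ℕ)) = 1 := by
  obtain ⟨k, rfl⟩ : ∃ k', k = k' + 1 := ⟨k - 1, by omega⟩
  rw [residueDet_of_monic (rootPoly_monic _ n) (natDegree_rootPoly _ n) _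
    fun j => ⟨facPoly_monic _ _, natDegree_facPoly _ _⟩,
    (modByMonic_eq_self_iff (rootPoly_monic _ n)).2 (degree_lt_degree ?_)]
  · exact coeff_facPoly_self _ _
  · rw [natDegree_facPoly, natDegree_rootPoly]
    exact (Fin.rev _).2

theorem coe_schurSym {k n : ℕ} (hk : 0 < k) (μ : YoungDiagram) :
    (schurSym k n μ : XPoly k n) = factorialSchur k n μ := by
  by_cases hμ : μ.rowLen k = 0
  · refine mul_right_cancel₀ (facVandermonde_xVar_ne_zero k n) ?_
    rw [factorialSchur_mul_facVandermonde hμ, schurSym, if_pos hμ]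
    have h1 := det_facPow_rev (n := n) (betaNumber k μ)
    have h2 := det_facPow_rev (n := n) fun j : Fin k => (j.rev : ℕ)
    rw [det_facPow_xVar (betaNumber k μ)] at h1
    rw [det_facPow_xVar fun j : Fin k => (j.rev : ℕ)] at h2
    rw [residueDet_facPoly_rev hk, map_one, mul_one] at h2
    simp only [Fin.rev_rev] at h2
    simp only [betaNumber, Fin.rev_rev] at h1
    rw [h1, facVandermonde, h2, ← symVal_apply]
    simp only [betaNumber]
    ring
  · rw [schurSym, if_neg hμ, factorialSchur_eq_zero (Nat.pos_of_ne_zero hμ)]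
    rfl

/-! ### Images in a quotient ring -/

variable {Q : Type*} [CommRing Q]

/-- The images of the torus weights. -/
def tImage {k n : ℕ} (π : SymRing k n →+* Q) (i : ℤ) : Q := π (tSym k n i)

theorem tImage_add_period {k n : ℕ} (π : SymRing k n →+* Q) (i : ℤ) :
    tImage π (i + n) = tImage π i := by
  rw [tImage, tSym_add_period, tImage]

/-- The image of the ratio of determinants with exponents `b`. -/
def imageDet {k n : ℕ} (π : SymRing k n →+* Q) (b : Fin k → ℕ) : Q :=
  residueDet ((rootPoly k n).map π) fun j => facPoly (tImage π) (b j)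

theorem map_schurSym {k n : ℕ} (π : SymRing k n →+* Q) {μ : YoungDiagram}
    (hμ : μ.rowLen k = 0) : π (schurSym k n μ) = imageDet π (betaNumber k μ) := by
  rw [schurSym, if_pos hμ, map_residueDet π (rootPoly_monic k n)]
  simp only [map_facPoly]
  rfl

/-- `h_m(x|t)` is the top coordinate of the residue of `(y|t)^(m + k - 1)`. -/
theorem coeff_facPoly_modByMonic {k n : ℕ} (π : SymRing (k + 1) n →+* Q) (m : ℕ) :
    (facPoly (tImage π) (m + k) %ₘ (rootPoly (k + 1) n).map π).coeff k =
      π (schurSym (k + 1) n (rowShape m)) := by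
  have h0 : (rowShape m).rowLen (k + 1) = 0 := by rw [rowLen_rowShape, if_neg (by omega)]
  have hb : betaNumber (k + 1) (rowShape m) 0 = m + k := by
    simp [betaNumber, rowLen_rowShape]
  have hb' : ∀ j : Fin k, betaNumber (k + 1) (rowShape m) j.succ = (j.succ.rev : ℕ) := by
    intro j
    simp [betaNumber, rowLen_rowShape]
  rw [schurSym, if_pos h0, residueDet_of_monic (rootPoly_monic _ n) (natDegree_rootPoly _ n) _
    fun j => ⟨facPoly_monic _ _, by rw [natDegree_facPoly, hb']⟩, hb, ← coeff_map,
    map_modByMonic _ (rootPoly_monic _ n), map_facPoly π]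
  rfl

/-- The relations that hold for the generators of `J`: `h_m(x|t) = 0` for `n - k < m < n`, and
`h_n(x|t) = c`. -/
structure SatisfiesRelations {k n : ℕ} (π : SymRing k n →+* Q) (c : Q) : Prop where
  rowShape_eq_zero : ∀ m, n - k + 1 ≤ m → m ≤ n - 1 → π (schurSym k n (rowShape m)) = 0
  rowShape_self : π (schurSym k n (rowShape n)) = c

/-- The polynomial `(y|t)^n = ∏ (y - t_i)` is congruent to `c` modulo `∏ (y - x_i)`: this is what
the relations express, through the nondegenerate pairing given by the top coordinate. -/
theorem SatisfiesRelations.facPoly_period {k n : ℕ} {π : SymRing k n →+* Q} {c : Q}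
    (hπ : SatisfiesRelations π c) (hk : 0 < k) (hkn : k ≤ n) :
    (facPoly (tImage π) n - C c) %ₘ (rootPoly k n).map π = 0 := by
  obtain ⟨k, rfl⟩ : ∃ k', k = k' + 1 := ⟨k - 1, by omega⟩
  nontriviality Q
  have hmonic : ((rootPoly (k + 1) n).map π).Monic := (rootPoly_monic _ n).map π
  have hdeg : ((rootPoly (k + 1) n).map π).natDegree = k + 1 :=
    ((rootPoly_monic (k + 1) n).natDegree_map π).trans (natDegree_rootPoly _ n)
  refine modByMonic_eq_zero_of_coeff hmonic hdeg (facPoly (tImage π))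
    (facPoly_monic _) (natDegree_facPoly _) _ fun i hi => ?_
  have hmul : facPoly (tImage π) n * facPoly (tImage π) i =
      facPoly (tImage π) (n - k + i + k) := by
    rw [show n - k + i + k = n + i by omega]
    exact (facPow_add_period (fun i => by rw [tImage_add_period]) _ _).symm
  rw [sub_mul, hmul, sub_modByMonic, coeff_sub, coeff_facPoly_modByMonic, ← smul_eq_C_mul,
    smul_modByMonic, coeff_smul, (modByMonic_eq_self_iff hmonic).2 (degree_lt_degree (by
      rw [natDegree_facPoly, hdeg]; omega))]
  rcases hi.eq_or_lt with rfl | hi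
  · rw [show n - i + i = n by omega, hπ.rowShape_self, coeff_facPoly_self, smul_eq_mul, mul_one,
      sub_self]
  · rw [hπ.rowShape_eq_zero _ (by omega) (by omega),
      coeff_eq_zero_of_natDegree_lt (by rwa [natDegree_facPoly]), smul_zero, sub_self]

theorem SatisfiesRelations.facPoly_add_period {k n : ℕ} {π : SymRing k n →+* Q} {c : Q}
    (hπ : SatisfiesRelations π c) (hk : 0 < k) (hkn : k ≤ n) (r : ℕ) :
    facPoly (tImage π) (r + n) %ₘ (rootPoly k n).map π =
      c • (facPoly (tImage π) r %ₘ (rootPoly k n).map π) := by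
  have hmul : facPoly (tImage π) (r + n) = facPoly (tImage π) n * facPoly (tImage π) r := by
    rw [add_comm]
    exact facPow_add_period (fun i => by rw [tImage_add_period]) _ _
  have h := mul_modByMonic (facPoly (tImage π) n - C c) (facPoly (tImage π) r)
    ((rootPoly k n).map π)
  rw [hπ.facPoly_period hk hkn, zero_mul, zero_modByMonic, sub_mul, sub_modByMonic,
    ← hmul, ← smul_eq_C_mul, smul_modByMonic] at h
  exact sub_eq_zero.1 h

/-- Lowering one exponent by `n` costs a factor `c`. -/
theorem SatisfiesRelations.imageDet_lower {k n : ℕ} {π : SymRing k n →+* Q} {c : Q}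
    (hπ : SatisfiesRelations π c) (hkn : k ≤ n) {b : Fin k → ℕ} {i : Fin k} {r : ℕ}
    (h : b i = r + n) : imageDet π b = c * imageDet π (Function.update b i r) := by
  rw [imageDet, residueDet_update_smul _ i c (facPoly (tImage π) r)
    (by rw [h]; exact hπ.facPoly_add_period ((Nat.zero_le _).trans_lt i.2) hkn r),
    imageDet]
  congr 2
  funext j
  rcases eq_or_ne j i with rfl | hj
  · simp
  · simp [hj]

theorem SatisfiesRelations.imageDet_eq_zero {k n : ℕ} {π : SymRing k n →+* Q} {c : Q}
    (hπ : SatisfiesRelations π c) (hkn : k ≤ n) {b : Fin k → ℕ} {i j : Fin k} (hij : i ≠ j)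
    (h : b i = b j + n) : imageDet π b = 0 := by
  rw [hπ.imageDet_lower hkn h, imageDet, residueDet_eq_zero_of_eq _ hij, mul_zero]
  simp [hij.symm]

theorem imageDet_comp_perm {k n : ℕ} (π : SymRing k n →+* Q) (b : Fin k → ℕ)
    (σ : Equiv.Perm (Fin k)) :
    imageDet π (b ∘ σ) = (Equiv.Perm.sign σ : Q) * imageDet π b :=
  residueDet_comp_perm (fun j => facPoly (tImage π) (b j)) σ

theorem satisfiesRelations_mk {k n : ℕ} (hk : 0 < k) :
    SatisfiesRelations (Ideal.Quotient.mk (J k n)) ((-1) ^ (k + 1) * qR k n) where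
  rowShape_eq_zero m h1 h2 := Ideal.Quotient.eq_zero_iff_mem.2
    (Ideal.subset_span (Or.inl ⟨m, h1, h2, coe_schurSym hk _⟩))
  rowShape_self := by
    have hmem : schurSym k n (rowShape n) +
        (-1) ^ k * algebraMap (QWeights n) (SymRing k n) (qParam n) ∈ J k n := by
      refine Ideal.subset_span (Or.inr ?_)
      have h1 : ((schurSym k n (rowShape n) +
          (-1) ^ k * algebraMap (QWeights n) (SymRing k n) (qParam n) : SymRing k n) :
            XPoly k n) = (schurSym k n (rowShape n) : XPoly k n) +
          (-1) ^ k * MvPolynomial.C (qParam n) := by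
        simp only [← symVal_apply, map_add, map_mul, map_pow, map_neg, map_one]
        rfl
      exact h1.trans (congrArg (· + _) (coe_schurSym hk _))
    have h := Ideal.Quotient.eq_zero_iff_mem.2 hmem
    rw [map_add, map_mul, map_pow, map_neg, map_one] at h
    rw [pow_succ, qR]
    linear_combination h

end

/-! ### Rim hooks and exponents -/

/-- The content of a box: column minus row. -/
def content (a : ℕ × ℕ) : ℤ := (a.2 : ℤ) - (a.1 : ℤ)

theorem mem_rim {μ : YoungDiagram} {a : ℕ × ℕ} : a ∈ rim μ ↔ a ∈ μ ∧ (a.1 + 1, a.2 + 1) ∉ μ := by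
  simp [rim]

/-- The rim meets every diagonal at most once. -/
theorem eq_of_content_eq {μ : YoungDiagram} {a b : ℕ × ℕ} (ha : a ∈ rim μ) (hb : b ∈ rim μ)
    (h : content a = content b) : a = b := by
  rw [mem_rim] at ha hb
  obtain ⟨i, j⟩ := a
  obtain ⟨i', j'⟩ := b
  simp only [content] at h
  rcases lt_trichotomy i i' with hi | hi | hi
  · exact absurd (μ.up_left_mem (by omega) (by omega) hb.1) ha.2
  · simp only [Prod.mk.injEq]
    omega
  · exact absurd (μ.up_left_mem (by omega) (by omega) ha.1) hb.2

theorem BoxAdj.symm {a b : ℕ × ℕ} (h : BoxAdj a b) : BoxAdj b a := by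
  unfold BoxAdj at h ⊢
  omega

/-- A path that leaves a set has a step that leaves it. -/
theorem exists_step_of_reflTransGen {α : Type*} {r : α → α → Prop} {a b : α}
    (h : Relation.ReflTransGen r a b) (P : α → Prop) (ha : P a) (hb : ¬ P b) :
    ∃ c d, r c d ∧ P c ∧ ¬ P d := by
  induction h with
  | refl => exact absurd ha hb
  | @tail c d _ hcd ih =>
    by_cases hc : P c
    · exact ⟨c, d, hcd, hc, hb⟩
    · exact ih hc

/-- Along a connected set of boxes, a function that varies by at most one between neighbours takes
all intermediate values. -/
theorem IsRimStrip.exists_eq {μ : YoungDiagram} {n : ℕ} {B : Finset (ℕ × ℕ)}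
    (hB : IsRimStrip μ n B) (f : ℕ × ℕ → ℤ) (hf : ∀ a b, BoxAdj a b → f b ≤ f a + 1)
    {a b : ℕ × ℕ} (ha : a ∈ B) (hb : b ∈ B) {m : ℤ} (ham : f a ≤ m) (hmb : m ≤ f b) :
    ∃ c ∈ B, f c = m := by
  rcases hmb.eq_or_lt with rfl | hmb
  · exact ⟨b, hb, rfl⟩
  · obtain ⟨c, d, ⟨hc, -, hcd⟩, h1, h2⟩ :=
      exists_step_of_reflTransGen (hB.2.2 a ha b hb) (fun c => f c ≤ m) ham (not_le.2 hmb)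
    have := hf c d hcd
    exact ⟨c, hc, by omega⟩

/-- The number of boxes of a rim strip is read off from the contents of its two ends. -/
theorem IsRimStrip.card_eq {μ : YoungDiagram} {n : ℕ} {B : Finset (ℕ × ℕ)}
    (hB : IsRimStrip μ n B) {lo hi : ℕ × ℕ} (hlo : lo ∈ B) (hhi : hi ∈ B)
    (h : ∀ b ∈ B, content lo ≤ content b ∧ content b ≤ content hi) :
    (n : ℤ) = content hi - content lo + 1 := by
  have himg : B.image content = Finset.Icc (content lo) (content hi) := by
    ext m
    rw [Finset.mem_image, Finset.mem_Icc]
    constructor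
    · rintro ⟨b, hb, rfl⟩
      exact h b hb
    · rintro ⟨h1, h2⟩
      refine hB.exists_eq content (fun a b hab => ?_) hlo hhi h1 h2
      unfold BoxAdj at hab
      unfold content
      omega
  have hcard : (B.image content).card = n := by
    rw [Finset.card_image_of_injOn, hB.2.1]
    exact fun a ha b hb hab => eq_of_content_eq (hB.1 ha) (hB.1 hb) hab
  rw [himg, Int.card_Icc] at hcard
  have := (h lo hlo).2
  omega

theorem val_rev_add {k : ℕ} (i : Fin k) : (i.rev : ℕ) + i + 1 = k := by
  rw [Fin.val_rev]
  omega

/-- An illegal hook makes one exponent exceed another by `n`. -/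
theorem IsIllegalRimHook.exists_betaNumber {k n : ℕ} {μ : YoungDiagram} {B : Finset (ℕ × ℕ)}
    (hμ : μ.rowLen k = 0) (hB : IsIllegalRimHook μ n B) :
    ∃ i j : Fin k, i ≠ j ∧ betaNumber k μ i = betaNumber k μ j + n := by
  obtain ⟨hS, ⟨r, j, hr, hr', hmin⟩, ⟨s, c, hs, hs', hmax⟩⟩ := hB
  have hrμ := (mem_rim.1 (hS.1 hr)).1
  have hsc := (mem_rim.1 (hS.1 hs)).2
  simp only at hsc
  rw [YoungDiagram.mem_iff_lt_rowLen] at hr' hrμ hs' hsc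
  have hrs : r ≤ s := hmin _ hs
  have hsk : s + 1 < k := by
    by_contra! hle
    have := μ.rowLen_anti _ _ hle
    omega
  have hn := hS.card_eq (lo := (s, c)) (hi := (r, j)) hs hr fun b hb => by
    have h1 := hmin b hb
    have h2 := hmax b hb
    have h3 := (mem_rim.1 (hS.1 hb)).1
    rw [show b = (b.1, b.2) from rfl, YoungDiagram.mem_iff_lt_rowLen] at h3
    have h4 := μ.rowLen_anti _ _ h1
    simp only [content]
    omega
  simp only [content] at hn
  refine ⟨⟨r, by omega⟩, ⟨s + 1, hsk⟩, fun h => ?_, ?_⟩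
  · have := congrArg Fin.val h
    simp only at this
    omega
  · have h1 := val_rev_add (⟨r, by omega⟩ : Fin k)
    have h2 := val_rev_add (⟨s + 1, hsk⟩ : Fin k)
    simp only [betaNumber]
    simp only at h1 h2
    omega

/-- The row lengths after the removal of a rim hook that occupies the rows from `r` to `s`. -/
theorem RemovesRimHook.exists_rows {n : ℕ} {μ ν : YoungDiagram} {B : Finset (ℕ × ℕ)}
    (hn : 0 < n) (hB : RemovesRimHook μ n B ν) :
    ∃ r s, r ≤ s ∧ 0 < μ.rowLen s ∧ height B = s - r + 1 ∧
      (∀ i, i < r ∨ s < i → ν.rowLen i = μ.rowLen i) ∧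
      (∀ i, r ≤ i → i < s → ν.rowLen i + 1 = μ.rowLen (i + 1)) ∧
      ν.rowLen s + n = μ.rowLen r + (s - r) := by
  obtain ⟨hS, hν⟩ := hB
  have hmem : ∀ i j, j < ν.rowLen i ↔ j < μ.rowLen i ∧ (i, j) ∉ B := by
    intro i j
    rw [← YoungDiagram.mem_iff_lt_rowLen, ← YoungDiagram.mem_iff_lt_rowLen,
      ← YoungDiagram.mem_cells, hν, Finset.mem_sdiff, YoungDiagram.mem_cells]
  have hBμ : ∀ {i j}, (i, j) ∈ B → j < μ.rowLen i := fun h => by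
    rw [← YoungDiagram.mem_iff_lt_rowLen]
    exact (mem_rim.1 (hS.1 h)).1
  have hBν : ∀ {i j}, (i, j) ∈ B → ν.rowLen i ≤ j := fun {i j} h =>
    not_lt.1 fun hlt => ((hmem i j).1 hlt).2 h
  have hne : (B.image Prod.fst).Nonempty := by
    rw [Finset.image_nonempty, ← Finset.card_pos, hS.2.1]
    exact hn
  set r := (B.image Prod.fst).min' hne with hr
  set s := (B.image Prod.fst).max' hne with hs
  obtain ⟨⟨r', jr⟩, hrB, hr'⟩ := Finset.mem_image.1 ((B.image Prod.fst).min'_mem hne)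
  obtain ⟨⟨s', js⟩, hsB, hs'⟩ := Finset.mem_image.1 ((B.image Prod.fst).max'_mem hne)
  simp only at hr' hs'
  rw [← hr] at hr'
  rw [← hs] at hs'
  rw [hr'] at hrB
  rw [hs'] at hsB
  have hrow : ∀ b ∈ B, r ≤ b.1 ∧ b.1 ≤ s := fun b hb =>
    ⟨Finset.min'_le _ _ (Finset.mem_image_of_mem _ hb),
      Finset.le_max' _ _ (Finset.mem_image_of_mem _ hb)⟩
  have hrs : r ≤ s := (hrow _ hrB).2
  have hμs := hBμ hsB
  have hμr := hBμ hrB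
  refine ⟨r, s, hrs, by omega, ?_, ?_, ?_, ?_⟩
  · have himg : B.image Prod.fst = Finset.Icc r s := by
      ext m
      rw [Finset.mem_image, Finset.mem_Icc]
      constructor
      · rintro ⟨b, hb, rfl⟩
        exact hrow b hb
      · rintro ⟨h1, h2⟩
        obtain ⟨c, hc, hcm⟩ := hS.exists_eq (fun c => (c.1 : ℤ)) (m := m) (fun a b hab => by
          unfold BoxAdj at hab
          omega) hrB hsB (by simpa using h1) (by simpa using h2)
        exact ⟨c, hc, by simpa using hcm⟩
    rw [height, himg, Nat.card_Icc]
    omega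
  · intro i hi
    refine eq_of_forall_lt_iff fun j => ?_
    rw [hmem]
    refine and_iff_left fun hb => ?_
    have := hrow _ hb
    simp only at this
    omega
  · intro i hri his
    -- the strip passes from row `i` to row `i + 1` through the last box of row `i + 1`
    obtain ⟨⟨i1, j1⟩, ⟨i2, j2⟩, ⟨hc, hd, hcd⟩, h1, h2⟩ := exists_step_of_reflTransGen
      (hS.2.2 _ hrB _ hsB) (fun c => c.1 ≤ i) hri (by simpa using his)
    simp only [BoxAdj] at hcd h1 h2
    obtain ⟨rfl, rfl, rfl⟩ : i1 = i ∧ i2 = i + 1 ∧ j1 = j2 := by omega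
    have h3 := (mem_rim.1 (hS.1 hc)).2
    rw [YoungDiagram.mem_iff_lt_rowLen] at h3
    simp only at h3
    have h4 := hBμ hd
    have h5 := hBν hc
    refine le_antisymm (by omega) ?_
    by_contra! hlt
    have h6 : (i1, j1 - 1) ∈ B := by
      by_contra hnot
      have := (hmem i1 (j1 - 1)).2 ⟨(Nat.sub_le _ _).trans_lt (hBμ hc), hnot⟩
      omega
    have h7 := (mem_rim.1 (hS.1 h6)).2
    rw [YoungDiagram.mem_iff_lt_rowLen] at h7
    simp only at h7
    omega
  · have hhi : (r, μ.rowLen r - 1) ∈ B := by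
      by_contra hnot
      have h1 := (hmem r (μ.rowLen r - 1)).2 ⟨by omega, hnot⟩
      have h2 := hBν hrB
      omega
    have hlo : (s, ν.rowLen s) ∈ B := by
      by_contra hnot
      have h1 := hBν hsB
      exact lt_irrefl _ ((hmem s (ν.rowLen s)).2 ⟨by omega, hnot⟩)
    have hcard := hS.card_eq hlo hhi fun b hb => by
      have h1 := hrow b hb
      have h2 : b.2 < μ.rowLen b.1 := hBμ hb
      have h3 : ν.rowLen b.1 ≤ b.2 := hBν hb
      have h4 := μ.rowLen_anti _ _ h1.1
      have h5 := ν.rowLen_anti _ _ h1.2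
      simp only [content]
      omega
    simp only [content] at hcard
    omega

/-- If the first row plus the number of rows exceeds `n`, the `n` boxes of the rim that follow the
end of the first row form a rim hook or an illegal one. -/
theorem hasRimHook_or_isIllegalRimHook {n : ℕ} {μ : YoungDiagram} (hn : 0 < n)
    (hμ : 0 < μ.rowLen 0) (h : n < μ.rowLen 0 + μ.colLen 0) :
    HasRimHook μ n ∨ ∃ B, IsIllegalRimHook μ n B := by
  set N : ℤ := (μ.rowLen 0 : ℤ) - n with hN
  set B := (rim μ).filter fun b => N ≤ content b with hBdef
  have hB : ∀ b, b ∈ B ↔ b ∈ rim μ ∧ N ≤ content b := fun b => by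
    rw [hBdef, Finset.mem_filter]
  have hfirst : (0, μ.rowLen 0 - 1) ∈ rim μ := by
    rw [mem_rim, YoungDiagram.mem_iff_lt_rowLen, YoungDiagram.mem_iff_lt_rowLen]
    have := μ.rowLen_anti 0 1 (by omega)
    simp only [zero_add]
    omega
  have hfirstc : content (0, μ.rowLen 0 - 1) = (μ.rowLen 0 : ℤ) - 1 := by
    simp only [content]
    omega
  have hstep : ∀ b ∈ rim μ, N < content b →
      ∃ b' ∈ rim μ, content b' = content b - 1 ∧ BoxAdj b b' := by
    rintro ⟨i, j⟩ hb hc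
    simp only [mem_rim] at hb
    simp only [content] at hc
    by_cases hdown : (i + 1, j) ∈ μ
    · refine ⟨(i + 1, j), mem_rim.2 ⟨hdown, fun hmem => hb.2 ?_⟩, ?_, ?_⟩
      · exact μ.up_left_mem (by simp) le_rfl hmem
      · simp only [content]
        omega
      · simp [BoxAdj]
    · have hj : 0 < j := by
        by_contra! hj
        obtain rfl : j = 0 := by omega
        rw [YoungDiagram.mem_iff_lt_colLen] at hdown
        omega
      refine ⟨(i, j - 1), mem_rim.2 ⟨μ.up_left_mem le_rfl (Nat.sub_le _ _) hb.1, ?_⟩, ?_, ?_⟩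
      · simp only [Nat.sub_add_cancel hj]
        exact hdown
      · simp only [content]
        omega
      · exact Or.inl ⟨rfl, Or.inr (Nat.sub_add_cancel hj)⟩
  -- the rim meets every diagonal in the range of contents of `B`
  have hex : ∀ d : ℕ, d < n → ∃ b ∈ B, content b = (μ.rowLen 0 : ℤ) - 1 - d := by
    intro d
    induction d with
    | zero => intro _; exact ⟨_, (hB _).2 ⟨hfirst, by omega⟩, by rw [hfirstc]; simp⟩
    | succ d ih =>
      intro hd
      obtain ⟨b, hb, hbc⟩ := ih (by omega)
      obtain ⟨b', hb', hc', -⟩ := hstep b ((hB b).1 hb).1 (by omega)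
      exact ⟨b', (hB _).2 ⟨hb', by omega⟩, by push_cast; omega⟩
  obtain ⟨e, he, hec⟩ := hex (n - 1) (by omega)
  have hec : content e = N := by omega
  have hmax : ∀ b ∈ B, content b ≤ (μ.rowLen 0 : ℤ) - 1 := by
    rintro ⟨i, j⟩ hb
    have h1 := (mem_rim.1 ((hB _).1 hb).1).1
    rw [YoungDiagram.mem_iff_lt_rowLen] at h1
    have := μ.rowLen_anti 0 i (by omega)
    simp only [content]
    omega
  have hconn : ∀ (m : ℕ) (b : ℕ × ℕ), b ∈ B → content b = N + m →
      Relation.ReflTransGen (fun c d => c ∈ B ∧ d ∈ B ∧ BoxAdj c d) b e := by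
    intro m
    induction m with
    | zero =>
      intro b hb hbc
      rw [eq_of_content_eq ((hB _).1 hb).1 ((hB _).1 he).1 (by rw [hbc, hec]; simp)]
    | succ m ih =>
      intro b hb hbc
      push_cast at hbc
      obtain ⟨b', hb', hc', hadj⟩ := hstep b ((hB b).1 hb).1 (by omega)
      have hb'B : b' ∈ B := (hB _).2 ⟨hb', by omega⟩
      exact (ih b' hb'B (by omega)).head ⟨hb, hb'B, hadj⟩
  have hsymm : Std.Symm fun c d : ℕ × ℕ => c ∈ B ∧ d ∈ B ∧ BoxAdj c d :=
    ⟨fun c d hcd => ⟨hcd.2.1, hcd.1, hcd.2.2.symm⟩⟩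
  have hstrip : IsRimStrip μ n B := by
    refine ⟨Finset.filter_subset _ _, ?_, ?_⟩
    · have himg : B.image content = Finset.Icc N ((μ.rowLen 0 : ℤ) - 1) := by
        ext m
        rw [Finset.mem_image, Finset.mem_Icc]
        constructor
        · rintro ⟨b, hb, rfl⟩
          exact ⟨((hB b).1 hb).2, hmax b hb⟩
        · rintro ⟨h1, h2⟩
          obtain ⟨b, hb, hbc⟩ := hex (((μ.rowLen 0 : ℤ) - 1 - m).toNat) (by omega)
          exact ⟨b, hb, by omega⟩
      rw [← Finset.card_image_of_injOn (f := content)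
        fun a ha b hb hab => eq_of_content_eq ((hB _).1 ha).1 ((hB _).1 hb).1 hab, himg,
        Int.card_Icc]
      omega
    · intro a ha b hb
      have h1 := ((hB a).1 ha).2
      have h2 := ((hB b).1 hb).2
      exact (hconn (content a - N).toNat a ha (by omega)).trans
        (Relation.ReflTransGen.stdSymm.symm _ _ (hconn (content b - N).toNat b hb (by omega)))
  obtain ⟨s, c⟩ := e
  have he' := mem_rim.1 ((hB _).1 he).1
  simp only at he'
  by_cases hdown : (s + 1, c) ∈ μ
  · refine Or.inr ⟨B, hstrip, ⟨0, μ.rowLen 0 - 1, (hB _).2 ⟨hfirst, by omega⟩, ?_, by simp⟩,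
      ⟨s, c, he, hdown, ?_⟩⟩
    · rw [YoungDiagram.mem_iff_lt_rowLen]
      omega
    · rintro ⟨i, j⟩ hb
      obtain ⟨hb1, hb2⟩ := (hB _).1 hb
      have hb3 := mem_rim.1 hb1
      simp only [content] at hb2 hec hb3
      simp only
      constructor
      · by_contra! hlt
        exact he'.2 (μ.up_left_mem (by omega) (by omega) hb3.1)
      · by_contra! hlt
        exact hb3.2 (μ.up_left_mem (by omega) (by omega) he'.1)
  · refine Or.inl ⟨B, ⟨μ.cells \ B, ?_⟩, hstrip, rfl⟩
    rintro ⟨i, j⟩ ⟨i', j'⟩ hle hmem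
    obtain ⟨hi, hj⟩ : i' ≤ i ∧ j' ≤ j := hle
    rw [Finset.mem_coe, Finset.mem_sdiff, YoungDiagram.mem_cells] at hmem ⊢
    refine ⟨μ.up_left_mem hi hj hmem.1, fun hB' => ?_⟩
    obtain ⟨hb1, hb2⟩ := (hB _).1 hB'
    have hb3 := mem_rim.1 hb1
    simp only [content] at hb2 hb3 hec
    have hrim : ∀ i'', i' ≤ i'' → (i'' + 1, j + 1) ∉ μ := fun i'' hi'' hm =>
      hb3.2 (μ.up_left_mem (by omega) (by omega) hm)
    have hlow : ¬ N ≤ content (i, j) := fun hN' =>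
      hmem.2 ((hB _).2 ⟨mem_rim.2 ⟨hmem.1, hrim i hi⟩, hN'⟩)
    simp only [content] at hlow
    obtain rfl : j' = j := by
      by_contra hne
      exact hb3.2 (μ.up_left_mem (by omega) (by omega) hmem.1)
    -- column `j'` crosses the last diagonal of `B` at the end box, which then has a box below it
    set i'' := ((j' : ℤ) - N).toNat with hi''
    have hmid : (i'', j') ∈ rim μ :=
      mem_rim.2 ⟨μ.up_left_mem (by omega) le_rfl hmem.1, hrim i'' (by omega)⟩
    have heq := eq_of_content_eq hmid ((hB _).1 he).1 (by simp only [content]; omega)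
    simp only [Prod.mk.injEq] at heq
    exact hdown (μ.up_left_mem (by omega) (by omega) hmem.1)

/-! ### Removal of rim hooks in the quotient ring -/

/-- Removing a rim hook lowers one exponent by `n` and moves it past those of the other rows that
the hook meets. -/
theorem SatisfiesRelations.imageDet_removesRimHook {Q : Type*} [CommRing Q] {k n : ℕ}
    {π : SymRing k n →+* Q} {c : Q} (hπ : SatisfiesRelations π c) (hk : 0 < k) (hkn : k ≤ n)
    {μ ν : YoungDiagram} {B : Finset (ℕ × ℕ)} (hμ : μ.rowLen k = 0)
    (hB : RemovesRimHook μ n B ν) :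
    imageDet π (betaNumber k μ) =
      c * (-1) ^ (height B + 1) * imageDet π (betaNumber k ν) := by
  obtain ⟨r, s, hrs, hs, hheight, hout, hin, hlast⟩ := hB.exists_rows (hk.trans_le hkn)
  have hsk : s < k := by
    by_contra! hle
    have := μ.rowLen_anti _ _ hle
    omega
  have : NeZero k := ⟨hk.ne'⟩
  set r' : Fin k := ⟨r, by omega⟩ with hr'
  set s' : Fin k := ⟨s, hsk⟩ with hs'
  have hrs' : r' ≤ s' := hrs
  have hrev : ∀ i : Fin k, (i.rev : ℕ) + i + 1 = k := val_rev_add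
  have hbeta : betaNumber k μ r' = betaNumber k ν s' + n := by
    have h1 := hrev r'
    have h2 := hrev s'
    simp only [betaNumber, hr', hs'] at h1 h2 ⊢
    omega
  have hperm : betaNumber k ν =
      Function.update (betaNumber k μ) r' (betaNumber k ν s') ∘ Fin.cycleIcc r' s' := by
    funext i
    rw [Function.comp_apply]
    rcases lt_trichotomy i s' with his | rfl | his
    · rcases lt_or_ge i r' with hir | hir
      · rw [Fin.cycleIcc_of_lt hir, Function.update_of_ne hir.ne, betaNumber, betaNumber,
          hout i (Or.inl hir)]
      · have hi1 : ((i + 1 : Fin k) : ℕ) = i + 1 := by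
          rw [Fin.val_add_one_of_lt' ?_]
          have : (i : ℕ) < s := his
          omega
        have hne : i + 1 ≠ r' := fun h => by
          have h1 := congrArg Fin.val h
          have h2 : r ≤ (i : ℕ) := hir
          simp only [hr'] at h1
          omega
        rw [Fin.cycleIcc_of_ge_of_lt hir his, Function.update_of_ne hne, betaNumber, betaNumber,
          hi1]
        have h1 := hin i hir his
        have h2 := hrev i
        have h3 := hrev (i + 1)
        omega
    · rw [Fin.cycleIcc_of_last hrs', Function.update_self]
    · rw [Fin.cycleIcc_of_gt his, Function.update_of_ne (hrs'.trans_lt his).ne', betaNumber,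
        betaNumber, hout i (Or.inr his)]
  have hsign : ((Equiv.Perm.sign (Fin.cycleIcc r' s') : ℤˣ) : Q) = (-1) ^ (height B + 1) := by
    rw [Fin.sign_cycleIcc_of_le hrs', hheight, add_assoc, pow_add _ (s - r)]
    simp [hr', hs']
  have hdet := imageDet_comp_perm π
    (Function.update (betaNumber k μ) r' (betaNumber k ν s')) (Fin.cycleIcc r' s')
  rw [← hperm, hsign] at hdet
  rw [hπ.imageDet_lower hkn hbeta, hdet, mul_assoc, ← mul_assoc ((-1) ^ (height B + 1)),
    ← mul_pow]
  simp

theorem RemovesRimHook.rowLen_eq_zero {k n : ℕ} {μ ν : YoungDiagram} {B : Finset (ℕ × ℕ)}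
    (hB : RemovesRimHook μ n B ν) (hμ : μ.rowLen k = 0) : ν.rowLen k = 0 := by
  by_contra hne
  have h1 : (k, 0) ∈ ν.cells := by
    rw [YoungDiagram.mem_cells, YoungDiagram.mem_iff_lt_rowLen]
    exact Nat.pos_of_ne_zero hne
  rw [hB.2, Finset.mem_sdiff, YoungDiagram.mem_cells, YoungDiagram.mem_iff_lt_rowLen] at h1
  omega

/-- The rim hook rule: the two signs combine to `(-1)^(k - h)`, written `(-1)^(k + h)`. -/
theorem SatisfiesRelations.map_schurSym_removesRimHook {Q : Type*} [CommRing Q] {k n : ℕ}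
    {π : SymRing k n →+* Q} {q : Q} (hπ : SatisfiesRelations π ((-1) ^ (k + 1) * q)) (hk : 0 < k)
    (hkn : k ≤ n) {μ ν : YoungDiagram} {B : Finset (ℕ × ℕ)} (hμ : μ.rowLen k = 0)
    (hB : RemovesRimHook μ n B ν) :
    π (schurSym k n μ) = (-1) ^ (k + height B) * q * π (schurSym k n ν) := by
  rw [map_schurSym π hμ, map_schurSym π (hB.rowLen_eq_zero hμ),
    hπ.imageDet_removesRimHook hk hkn hμ hB]
  ring

/-- If the first row is too long and no rim hook can be removed, two exponents differ by `n`. -/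
theorem exists_betaNumber_of_not_hasRimHook {k n : ℕ} {μ : YoungDiagram} (hk : 0 < k)
    (hkn : k ≤ n) (hμ : μ.rowLen k = 0) (hlong : n - k < μ.rowLen 0) (hno : ¬ HasRimHook μ n) :
    ∃ i j : Fin k, i ≠ j ∧ betaNumber k μ i = betaNumber k μ j + n := by
  by_cases h : n < μ.rowLen 0 + μ.colLen 0
  · rcases hasRimHook_or_isIllegalRimHook (hk.trans_le hkn) (by omega) h with h | ⟨B, hB⟩
    · exact absurd h hno
    · exact hB.exists_betaNumber hμ
  · -- the lowered exponent is that of an empty row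
    have hcol : 0 < μ.colLen 0 := by
      rw [← YoungDiagram.mem_iff_lt_colLen, YoungDiagram.mem_iff_lt_rowLen]
      omega
    have hlast : μ.rowLen (n - μ.rowLen 0) = 0 := by
      by_contra hne
      have hmem : (n - μ.rowLen 0, 0) ∈ μ :=
        YoungDiagram.mem_iff_lt_rowLen.2 (Nat.pos_of_ne_zero hne)
      rw [YoungDiagram.mem_iff_lt_colLen] at hmem
      omega
    refine ⟨⟨0, hk⟩, ⟨n - μ.rowLen 0, by omega⟩, fun h => ?_, ?_⟩
    · have := congrArg Fin.val h
      simp only at this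
      omega
    · have h1 := val_rev_add (⟨0, hk⟩ : Fin k)
      have h2 := val_rev_add (⟨n - μ.rowLen 0, by omega⟩ : Fin k)
      simp only [betaNumber, hlast]
      simp only at h1 h2
      omega

theorem schurSym_eq_zero {k n : ℕ} {μ : YoungDiagram} (hμ : 0 < μ.rowLen k) :
    schurSym k n μ = 0 := if_neg hμ.ne'

end

end EquivRimHook

theorem proposition5p1 (k n : ℕ) (hk : 0 < k) (hkn : k ≤ n) :
    ∃ s : YoungDiagram → EquivRimHook.SymRing k n,
      (∀ μ : YoungDiagram, (s μ : EquivRimHook.XPoly k n) = EquivRimHook.factorialSchur k n μ) ∧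
      ∀ μ : YoungDiagram,
        (n - k < μ.rowLen 0 → ¬ EquivRimHook.HasRimHook μ n →
          Ideal.Quotient.mk (EquivRimHook.J k n) (s μ) = 0) ∧
        (0 < μ.rowLen k → Ideal.Quotient.mk (EquivRimHook.J k n) (s μ) = 0) ∧
        ((∃ B, EquivRimHook.IsIllegalRimHook μ n B) →
          Ideal.Quotient.mk (EquivRimHook.J k n) (s μ) = 0) ∧
        (∀ (B : Finset (ℕ × ℕ)) (ν : YoungDiagram), μ.rowLen k = 0 →
          EquivRimHook.RemovesRimHook μ n B ν →
          Ideal.Quotient.mk (EquivRimHook.J k n) (s μ) =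
            (-1) ^ (k + EquivRimHook.height B) * EquivRimHook.qR k n *
              Ideal.Quotient.mk (EquivRimHook.J k n) (s ν)) := by
  have hπ := EquivRimHook.satisfiesRelations_mk (n := n) hk
  refine ⟨EquivRimHook.schurSym k n, EquivRimHook.coe_schurSym hk, fun μ => ?_⟩
  have hb : 0 < μ.rowLen k →
      Ideal.Quotient.mk (EquivRimHook.J k n) (EquivRimHook.schurSym k n μ) = 0 := fun h => by
    rw [EquivRimHook.schurSym_eq_zero h]
    exact map_zero (Ideal.Quotient.mk (EquivRimHook.J k n))
  have hzero : (μ.rowLen k = 0 → ∃ i j : Fin k, i ≠ j ∧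
      EquivRimHook.betaNumber k μ i = EquivRimHook.betaNumber k μ j + n) →
      Ideal.Quotient.mk (EquivRimHook.J k n) (EquivRimHook.schurSym k n μ) = 0 := fun h => by
    rcases Nat.eq_zero_or_pos (μ.rowLen k) with h0 | h0
    · obtain ⟨i, j, hij, hβ⟩ := h h0
      exact (EquivRimHook.map_schurSym _ h0).trans (hπ.imageDet_eq_zero hkn hij hβ)
    · exact hb h0
  refine ⟨fun hlong hno => hzero fun h0 =>
      EquivRimHook.exists_betaNumber_of_not_hasRimHook hk hkn h0 hlong hno, hb,
    fun ⟨B, hB⟩ => hzero fun h0 => hB.exists_betaNumber h0, fun B ν h0 hB =>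
    hπ.map_schurSym_removesRimHook hk hkn h0 hB⟩
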